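/- Let $n\ge 2$. All manifolds, functions and tensor fields are smooth, manifolds are connected (Hausdorff, second countable), and hypersurfaces are embedded. Let $(\mathbb R\times M^n,\ \mathfrak g=-N^2dt^2+g,\ \Psi)$ be an electrostatic spacetime: $(M^n,g)$ is a Riemannian manifold, and $N\colon M\to(0,\infty)$ (the lapse) and $\Psi\colon M\to\mathbb R$ (the electric potential) are smooth functions; no field equations are assumed. A connected timelike hypersurface $P^n\subset\mathbb R\times M$ is a *photon surface* if every null geodesic of $(\mathbb R\times M,\mathfrak g)$ that is initially tangent to $P$ remains in $P$ and tangent to $P$ as long as it exists. It is *equipotential* if $N$, $\Psi$ and $|d\Psi|$ are constant on each time slice $\Sigma(t)=P\cap(\{t\}\times M)$, and *non-degenerate* if $dN\neq0$ along $P$. It is a *photon sphere* if $P=\mathbb R\times\Sigma$ for a hypersurface $\Sigma\subset M$ and $N$, $\Psi$, $|d\Psi|$ are constant along $P$. For an equipotential photon surface $P$ let $\mathcal T=\{t\in\mathbb R:\Sigma(t)\neq\emptyset\}$, let $u\colon\mathcal T\to\mathbb R$ be the function whose value at $t$ is the constant value of $N$ on $\Sigma(t)$, and call $t\in\mathcal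 T$ *exceptional* if $\dot u(t)=0$. **Proposition.** Let $P$ be a non-degenerate equipotential photon surface in an electrostatic spacetime. 1. If $P$ is not a photon sphere, then the set of exceptional times of $P$ is at most countable, and there is a constant $\varepsilon>0$ such that $|t-t'|>\varepsilon$ for any two distinct exceptional times $t,t'$. 2. If the set of exceptional times of $P$ has an accumulation point $t_0\in\mathcal T$, then $P$ is a photon sphere. (Equivalently, if $P$ is not a photon sphere, its exceptional times do not accumulate in $\mathcal T$.) -/

import Mathlib

open Set Filter Topology
open scoped Manifold ContDiff

noncomputable section

namespace PhotonSurface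

/-! ## Embedded hypersurfaces and geodesics in a manifold -/

section General

variable {E : Type*} [NormedAddCommGroup E] [NormedSpace ℝ E]
  {H : Type*} [TopologicalSpace H] (I : ModelWithCorners ℝ E H)
  {X : Type*} [TopologicalSpace X] [ChartedSpace H X]

/-- Near the point `p`, the set `S` is the zero set of the smooth function `F`, and the differential
of `F` does not vanish there. -/
def IsDefiningFunctionAt (S : Set X) (p : X) (F : X → ℝ) : Prop :=
  ∃ U : Set X, IsOpen U ∧ p ∈ U ∧ ContMDiffOn I 𝓘(ℝ, ℝ) ∞ F U ∧
    (∀ q ∈ U, mfderiv I 𝓘(ℝ, ℝ) F q ≠ 0) ∧ ∀ q ∈ U, (q ∈ S ↔ F q = 0)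

/-- A smooth embedded hypersurface (not necessarily closed as a subset): locally a regular level
set of a smooth function. -/
def IsHypersurface (S : Set X) : Prop :=
  ∀ p ∈ S, ∃ F : X → ℝ, IsDefiningFunctionAt I S p F

/-- The tangent space at `p` of an embedded hypersurface `S`: the kernel of the differential of a
local defining function. (All local defining functions give the same kernel.) -/
def tangentSet (S : Set X) (p : X) : Set (TangentSpace I p) :=
  {v | ∃ F : X → ℝ, IsDefiningFunctionAt I S p F ∧ mfderiv I 𝓘(ℝ, ℝ) F p v = 0}

/-- The velocity of a curve in a manifold. -/
def velocity (γ : ℝ → X) (s : ℝ) : TangentSpace I (γ s) :=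
  mfderiv 𝓘(ℝ, ℝ) I γ s (1 : ℝ)

/-- The coefficients, in the chart around `x₀`, of a field `G` of bilinear forms on the tangent
spaces of a manifold. -/
def localForm (G : ∀ p : X, TangentSpace I p → TangentSpace I p → ℝ) (x₀ : X) (y v w : E) : ℝ :=
  G ((extChartAt I x₀).symm y)
    (mfderivWithin 𝓘(ℝ, E) I (extChartAt I x₀).symm (range I) y v)
    (mfderivWithin 𝓘(ℝ, E) I (extChartAt I x₀).symm (range I) y w)

/-- The geodesic equation at the parameter `s`, in the coordinates `c` given by the chart around
`x₀`: `d/ds (G_{ij} ċ^j) = (1/2) (∂_i G_{jk}) ċ^j ċ^k`, which is the Euler-Lagrange equation of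
`(1/2) G(γ̇, γ̇)`. For a nondegenerate symmetric `G` this is `∇_γ̇ γ̇ = 0` with the Levi-Civita
connection of `G`, and the equation does not depend on the chart. -/
def GeodesicEquationAt (G : ∀ p : X, TangentSpace I p → TangentSpace I p → ℝ) (x₀ : X)
    (γ : ℝ → X) (s : ℝ) : Prop :=
  let c : ℝ → E := fun r => extChartAt I x₀ (γ r)
  ∀ w : E, HasDerivAt (fun r => localForm I G x₀ (c r) (deriv c r) w)
    ((1 / 2 : ℝ) *
      fderivWithin ℝ (fun y => localForm I G x₀ y (deriv c s) (deriv c s)) (range I) (c s) w) s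

/-- `γ` is a geodesic of `G` on the open interval `J`: it is smooth, and at each parameter it
satisfies the geodesic equation in local coordinates. -/
structure IsGeodesicOn (G : ∀ p : X, TangentSpace I p → TangentSpace I p → ℝ) (γ : ℝ → X)
    (J : Set ℝ) : Prop where
  isOpen : IsOpen J
  ordConnected : J.OrdConnected
  smooth : ContMDiffOn 𝓘(ℝ, ℝ) I ∞ γ J
  equation : ∀ s ∈ J, ∃ x₀ : X, γ s ∈ (chartAt H x₀).source ∧ GeodesicEquationAt I G x₀ γ s

/-- A null geodesic: a geodesic whose velocity is a nonzero null vector. -/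
structure IsNullGeodesicOn (G : ∀ p : X, TangentSpace I p → TangentSpace I p → ℝ) (γ : ℝ → X)
    (J : Set ℝ) : Prop extends IsGeodesicOn I G γ J where
  velocity_ne_zero : ∀ s ∈ J, velocity I γ s ≠ 0
  null : ∀ s ∈ J, G (γ s) (velocity I γ s) (velocity I γ s) = 0

end General

/-! ## Electrostatic spacetimes -/

/-- The data of an electrostatic spacetime `(ℝ × M, -N² dt² + g, Ψ)`: a smooth Riemannian metric
`g`, a smooth positive lapse function `N` and a smooth electric potential `Ψ` on the `n`-manifold
`M`. No field equations are imposed. -/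
structure ElectrostaticSystem (n : ℕ) (M : Type*) [TopologicalSpace M]
    [ChartedSpace (EuclideanSpace ℝ (Fin n)) M] [IsManifold (𝓡 n) ∞ M] where
  /-- the Riemannian metric `g` -/
  metric : Bundle.ContMDiffRiemannianMetric (𝓡 n) ∞ (EuclideanSpace ℝ (Fin n))
    (fun x : M => TangentSpace (𝓡 n) x)
  /-- the lapse function `N` -/
  lapse : M → ℝ
  lapse_smooth : ContMDiff (𝓡 n) 𝓘(ℝ, ℝ) ∞ lapse
  lapse_pos : ∀ x, 0 < lapse x
  /-- the electric potential `Ψ` -/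
  potential : M → ℝ
  potential_smooth : ContMDiff (𝓡 n) 𝓘(ℝ, ℝ) ∞ potential

/-- The model with corners of the spacetime manifold `ℝ × M`. -/
abbrev spacetimeModel (n : ℕ) : ModelWithCorners ℝ (ℝ × EuclideanSpace ℝ (Fin n))
    (ModelProd ℝ (EuclideanSpace ℝ (Fin n))) :=
  𝓘(ℝ, ℝ).prod (𝓡 n)

namespace ElectrostaticSystem

variable {n : ℕ} {M : Type*} [TopologicalSpace M]
  [ChartedSpace (EuclideanSpace ℝ (Fin n)) M] [IsManifold (𝓡 n) ∞ M]
  (S : ElectrostaticSystem n M)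

/-- The Lorentzian metric `-N² dt² + g` on `ℝ × M`. -/
def lorentzMetric (p : ℝ × M) (v w : TangentSpace (spacetimeModel n) p) : ℝ :=
  -(S.lapse p.2) ^ 2 * (v.1 * w.1) + S.metric.inner p.2 v.2 w.2

/-- The length `|dΨ|` at a point of `M`, as the dual norm
`sup {dΨ(v) : g(v, v) ≤ 1}`. As `Ψ` does not
depend on time, this is also its length with respect to the spacetime metric. -/
def potentialSlope (x : M) : ℝ :=
  sSup {r : ℝ | ∃ v : TangentSpace (𝓡 n) x,
    S.metric.inner x v v ≤ 1 ∧ r = mfderiv (𝓡 n) 𝓘(ℝ, ℝ) S.potential x v}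

/-- A photon surface: a connected, embedded hypersurface of the spacetime which is timelike (its
tangent hyperplanes contain timelike vectors) and null totally geodesic: every null geodesic
initially tangent to it remains in it and tangent to it as long as it exists. -/
structure IsPhotonSurface (P : Set (ℝ × M)) : Prop where
  hypersurface : IsHypersurface (spacetimeModel n) P
  connected : IsConnected P
  timelike : ∀ p ∈ P, ∃ v ∈ tangentSet (spacetimeModel n) P p, S.lorentzMetric p v v < 0
  null_totally_geodesic : ∀ (γ : ℝ → ℝ × M) (J : Set ℝ),
    IsNullGeodesicOn (spacetimeModel n) S.lorentzMetric γ J → 0 ∈ J →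
    γ 0 ∈ P → velocity (spacetimeModel n) γ 0 ∈ tangentSet (spacetimeModel n) P (γ 0) →
    ∀ s ∈ J, γ s ∈ P ∧ velocity (spacetimeModel n) γ s ∈ tangentSet (spacetimeModel n) P (γ s)

/-- `N`, `Ψ` and `|dΨ|` are constant on each time slice of `P`. -/
def IsEquipotential (P : Set (ℝ × M)) : Prop :=
  ∀ (t : ℝ) (x y : M), (t, x) ∈ P → (t, y) ∈ P →
    S.lapse x = S.lapse y ∧ S.potential x = S.potential y ∧
      S.potentialSlope x = S.potentialSlope y

/-- `dN ≠ 0` along `P`. -/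
def IsNondegenerate (P : Set (ℝ × M)) : Prop :=
  ∀ p ∈ P, mfderiv (𝓡 n) 𝓘(ℝ, ℝ) S.lapse p.2 ≠ 0

/-- A photon sphere: a photon surface of the form `ℝ × Σ`, for a hypersurface `Σ` of `M`, along
which `N`, `Ψ` and `|dΨ|` are constant. -/
def IsPhotonSphere (P : Set (ℝ × M)) : Prop :=
  S.IsPhotonSurface P ∧
  (∃ Sig : Set M, IsHypersurface (𝓡 n) Sig ∧ P = (univ : Set ℝ) ×ˢ Sig) ∧
  ∀ p ∈ P, ∀ q ∈ P, S.lapse p.2 = S.lapse q.2 ∧ S.potential p.2 = S.potential q.2 ∧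
    S.potentialSlope p.2 = S.potentialSlope q.2

/-- The set `𝒯` of times whose time slice of `P` is nonempty. -/
def times (P : Set (ℝ × M)) : Set ℝ := {t | ∃ x, (t, x) ∈ P}

open Classical in
/-- The lapse function `u` along an equipotential `P`: for `t ∈ 𝒯`, the value of `N` on the time
slice of `P` at time `t`. -/
def lapseAlong (P : Set (ℝ × M)) (t : ℝ) : ℝ :=
  if h : ∃ x, (t, x) ∈ P then S.lapse h.choose else 0

/-- The exceptional times: the `t ∈ 𝒯` with `u̇(t) = 0`. -/
def exceptionalTimes (P : Set (ℝ × M)) : Set ℝ :=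
  {t | t ∈ times P ∧ deriv (S.lapseAlong P) t = 0}

end ElectrostaticSystem

end PhotonSurface

end

/-! The heart of the proof is that `P` is invariant under the reflection `t ↦ 2a - t` at each of its
exceptional times `a` (`reflect_mem_of_exceptional`). Composing the reflections at `a` and `b` gives
the translation by `2(b - a)`. If exceptional times come arbitrarily close to each other, the
translations preserving `P` are therefore dense in `ℝ`, which forces `u` to be constant and `P` to
be a product `ℝ × Σ` (`isPhotonSphere_of_close`). Both claims follow: exceptional times of any other
`P` are uniformly separated, hence countable, and they cannot accumulate.

For the reflection, `dN ≠ 0` makes `P` locally the set `N = u(t)` (`eventually_mem_iff`), with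
tangent vectors those satisfying `dN(v₂) = u̇ v₁` (`mem_tangentSet_iff`). The reflection is an
isometry, as the metric is static. At `(a, x)` in `P` with `u̇(a) = 0` it preserves the point and
the tangent space of `P`, so it maps a null geodesic tangent to `P` there to another one; both stay
in `P`. Time is a local parameter along null geodesics, so comparing `N` on the two curves gives
`u(t) = u(2a - t)` near `a` (`eventually_lapseAlong_symm`).

To pass from one point to all of `P`, consider the points whose reflection lies in `P` and near
whose time `u` is symmetric about `a`. They form an open subset of `P`, and a null geodesic in `P`
that meets this set stays in it. Such a saturated open set is also closed in `P`
(`eventually_notMem_of_saturated`): otherwise take a point `A` of the set close to its complement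
and a nearest complementary point `C` in `P`. Null geodesics through `C` remain in the complement,
so the chord from `A` to `C` is orthogonal to every null tangent vector at `C`. These span the
tangent space, since `n ≥ 2` (`eq_zero_of_null_eq_zero`), whereas short chords of a hypersurface are
never normal to it (`exists_tangent_not_orthogonal`). As `P` is connected, the set is all of `P`. -/

namespace PhotonSurface

set_option linter.unusedSectionVars false

/-! ## Local solutions of the geodesic equation in a normed space -/

section ODE

variable {E : Type*} [NormedAddCommGroup E] [NormedSpace ℝ E]

/-- A solution of an autonomous differential equation with smooth right hand side is smooth. -/
theorem contDiffOn_of_hasDerivAt_autonomous {f : E → E} {O : Set E} {z : ℝ → E} {J : Set ℝ}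
    (hf : ContDiffOn ℝ ∞ f O) (hJ : IsOpen J) (hzO : ∀ s ∈ J, z s ∈ O)
    (hz : ∀ s ∈ J, HasDerivAt z (f (z s)) s) : ContDiffOn ℝ ∞ z J := by
  rw [contDiffOn_infty]
  intro k
  induction k with
  | zero =>
    exact contDiffOn_zero.2 fun s hs => (hz s hs).continuousAt.continuousWithinAt
  | succ k ih =>
    push_cast
    rw [contDiffOn_succ_iff_deriv_of_isOpen hJ]
    refine ⟨fun s hs => (hz s hs).differentiableAt.differentiableWithinAt, by simp, ?_⟩
    have h : ContDiffOn ℝ k (fun s => f (z s)) J :=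
      (hf.of_le (by exact_mod_cast le_top)).comp ih hzO
    exact h.congr fun s hs => (hz s hs).deriv

/-- Local existence of smooth solutions of an autonomous differential equation with smooth right
hand side. -/
theorem exists_smooth_solution [CompleteSpace E] {f : E → E} {O : Set E}
    (hO : IsOpen O) (hf : ContDiffOn ℝ ∞ f O) {z₀ : E} (hz₀ : z₀ ∈ O) :
    ∃ (z : ℝ → E) (ε : ℝ), 0 < ε ∧ z 0 = z₀ ∧ (∀ s ∈ Ioo (-ε) ε, z s ∈ O) ∧
      (∀ s ∈ Ioo (-ε) ε, HasDerivAt z (f (z s)) s) ∧ ContDiffOn ℝ ∞ z (Ioo (-ε) ε) := by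
  have h1 : ContDiffAt ℝ 1 f z₀ :=
    ((hf z₀ hz₀).contDiffAt (hO.mem_nhds hz₀)).of_le (by exact_mod_cast le_top)
  obtain ⟨z, hz0, ε, hε, hz⟩ :=
    h1.exists_forall_mem_closedBall_exists_eq_forall_mem_Ioo_hasDerivAt₀ 0
  simp only [zero_sub, zero_add] at hz
  have hc : ContinuousAt z 0 := (hz 0 ⟨by linarith, hε⟩).continuousAt
  have hev : ∀ᶠ s in 𝓝 (0 : ℝ), z s ∈ O := hc (hO.mem_nhds (hz0 ▸ hz₀))
  obtain ⟨δ, hδ, hδO⟩ := Metric.eventually_nhds_iff.1 hev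
  have hm : 0 < min ε δ := lt_min hε hδ
  have hsub : ∀ s ∈ Ioo (-min ε δ) (min ε δ), z s ∈ O := fun s hs => hδO (by
    rw [Real.dist_eq, sub_zero, abs_lt]
    exact ⟨by linarith [hs.1, min_le_right ε δ], by linarith [hs.2, min_le_right ε δ]⟩)
  have hd : ∀ s ∈ Ioo (-min ε δ) (min ε δ), HasDerivAt z (f (z s)) s := fun s hs =>
    hz s ⟨by linarith [hs.1, min_le_left ε δ], by linarith [hs.2, min_le_left ε δ]⟩
  exact ⟨z, _, hm, hz0, hsub, hd, contDiffOn_of_hasDerivAt_autonomous hf isOpen_Ioo hsub hd⟩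

end ODE

section LocalGeodesic

set_option maxSynthPendingDepth 3

variable {V : Type*} [NormedAddCommGroup V] [NormedSpace ℝ V] [FiniteDimensional ℝ V]

/-- An injective linear map from a finite-dimensional space to its dual is invertible. -/
theorem isInvertible_of_injective_dual (b : V →L[ℝ] V →L[ℝ] ℝ) (hb : ∀ v, b v = 0 → v = 0) :
    b.IsInvertible := by
  have hinj : Function.Injective (b : V →ₗ[ℝ] V →L[ℝ] ℝ) :=
    (injective_iff_map_eq_zero _).2 hb
  have hfin : Module.finrank ℝ V = Module.finrank ℝ (V →L[ℝ] ℝ) := by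
    rw [← (LinearMap.toContinuousLinearMap (𝕜 := ℝ) (E := V) (F' := ℝ)).finrank_eq]
    exact Subspace.dual_finrank_eq.symm
  exact ⟨(LinearMap.linearEquivOfInjective _ hinj hfin).toContinuousLinearEquiv, by ext; rfl⟩

/-- The right hand side of the geodesic equation of `B` in Hamiltonian form. -/
noncomputable def hamiltonianField (B : V → V →L[ℝ] V →L[ℝ] ℝ) (z : V × (V →L[ℝ] ℝ)) :
    V × (V →L[ℝ] ℝ) :=
  ((B z.1).inverse z.2,
    (1 / 2 : ℝ) • ((fderiv ℝ B z.1).flip ((B z.1).inverse z.2)).flip ((B z.1).inverse z.2))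

/-- Inversion of linear maps is smooth at invertible ones, and nondegeneracy makes `B y` invertible
in finite dimension. -/
theorem contDiffOn_hamiltonianField {B : V → V →L[ℝ] V →L[ℝ] ℝ} {O : Set V} (hO : IsOpen O)
    (hB : ContDiffOn ℝ ∞ B O) (hinj : ∀ y ∈ O, ∀ v, B y v = 0 → v = 0) :
    ContDiffOn ℝ ∞ (hamiltonianField B) (O ×ˢ univ) := by
  have hfst : ContDiffOn ℝ ∞ (fun z : V × (V →L[ℝ] ℝ) => z.1) (O ×ˢ univ) := contDiffOn_fst
  have hmaps : MapsTo (fun z : V × (V →L[ℝ] ℝ) => z.1) (O ×ˢ univ) O := fun z hz => hz.1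
  have hBz : ContDiffOn ℝ ∞ (fun z : V × (V →L[ℝ] ℝ) => B z.1) (O ×ˢ univ) :=
    hB.comp hfst hmaps
  have hinv : ContDiffOn ℝ ∞ (fun z : V × (V →L[ℝ] ℝ) => (B z.1).inverse) (O ×ˢ univ) :=
    fun z hz => ContDiffAt.comp_contDiffWithinAt z (g := ContinuousLinearMap.inverse)
      (isInvertible_of_injective_dual _ (hinj z.1 hz.1)).contDiffAt_map_inverse (hBz z hz)
  have hu : ContDiffOn ℝ ∞ (fun z : V × (V →L[ℝ] ℝ) => (B z.1).inverse z.2) (O ×ˢ univ) :=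
    hinv.clm_apply contDiffOn_snd
  have hdB : ContDiffOn ℝ ∞ (fun z : V × (V →L[ℝ] ℝ) => fderiv ℝ B z.1) (O ×ˢ univ) :=
    (hB.fderiv_of_isOpen hO (by simp)).comp hfst hmaps
  have hflip : ContDiffOn ℝ ∞ (fun z : V × (V →L[ℝ] ℝ) => (fderiv ℝ B z.1).flip) (O ×ˢ univ) :=
    (ContinuousLinearMap.flipₗᵢ ℝ V V (V →L[ℝ] ℝ)).contDiff.comp_contDiffOn hdB
  have hflip2 : ContDiffOn ℝ ∞ (fun z : V × (V →L[ℝ] ℝ) =>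
      ((fderiv ℝ B z.1).flip ((B z.1).inverse z.2)).flip) (O ×ˢ univ) :=
    (ContinuousLinearMap.flipₗᵢ ℝ V V ℝ).contDiff.comp_contDiffOn (hflip.clm_apply hu)
  exact hu.prodMk ((hflip2.clm_apply hu).const_smul (1 / 2 : ℝ))

/-- Local existence of geodesics of a smooth field of nondegenerate symmetric bilinear forms on an
open subset of a vector space; the energy is conserved. -/
theorem exists_local_geodesic {B : V → V →L[ℝ] V →L[ℝ] ℝ} {O : Set V} (hO : IsOpen O)
    (hB : ContDiffOn ℝ ∞ B O) (hinj : ∀ y ∈ O, ∀ v, B y v = 0 → v = 0)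
    (hsymm : ∀ y ∈ O, ∀ v w, B y v w = B y w v) {y₀ : V} (hy₀ : y₀ ∈ O) {v₀ : V} (hv₀ : v₀ ≠ 0) :
    ∃ (c : ℝ → V) (ε : ℝ), 0 < ε ∧ c 0 = y₀ ∧ deriv c 0 = v₀ ∧
      ContDiffOn ℝ ∞ c (Ioo (-ε) ε) ∧
      ∀ s ∈ Ioo (-ε) ε, c s ∈ O ∧ deriv c s ≠ 0 ∧
        B (c s) (deriv c s) (deriv c s) = B y₀ v₀ v₀ ∧
        ∀ w, HasDerivAt (fun r => B (c r) (deriv c r) w)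
          ((1 / 2 : ℝ) * fderiv ℝ (fun y => B y (deriv c s) (deriv c s)) (c s) w) s := by
  obtain ⟨z, ε, hε, hz0, hzO, hz, hsm⟩ := exists_smooth_solution
    (hO.prod isOpen_univ) (contDiffOn_hamiltonianField hO hB hinj)
    (z₀ := (y₀, B y₀ v₀)) ⟨hy₀, mem_univ _⟩
  have hright : ∀ y ∈ O, ∀ p, B y ((B y).inverse p) = p := fun y hy p => by
    obtain ⟨e, he⟩ := isInvertible_of_injective_dual _ (hinj y hy)
    rw [← he, ContinuousLinearMap.inverse_equiv]
    simp
  have hleft : ∀ y ∈ O, ∀ v, (B y).inverse (B y v) = v := fun y hy v => by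
    obtain ⟨e, he⟩ := isInvertible_of_injective_dual _ (hinj y hy)
    rw [← he, ContinuousLinearMap.inverse_equiv]
    simp
  set c : ℝ → V := fun s => (z s).1 with hc
  have hcO : ∀ s ∈ Ioo (-ε) ε, c s ∈ O := fun s hs => (hzO s hs).1
  have hcd : ∀ s ∈ Ioo (-ε) ε, HasDerivAt c ((B (c s)).inverse (z s).2) s := fun s hs =>
    (hasFDerivAt_fst (p := z s)).comp_hasDerivAt s (hz s hs)
  have hpd : ∀ s ∈ Ioo (-ε) ε, HasDerivAt (fun r => (z r).2) (hamiltonianField B (z s)).2 s :=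
    fun s hs => (hasFDerivAt_snd (p := z s)).comp_hasDerivAt s (hz s hs)
  -- The second component of the solution is the momentum of `c`, so its equation is the
  -- Euler-Lagrange equation of the energy.
  have hp : ∀ s ∈ Ioo (-ε) ε, B (c s) (deriv c s) = (z s).2 := fun s hs => by
    rw [(hcd s hs).deriv, hright _ (hcO s hs)]
  have hcsm : ContDiffOn ℝ ∞ c (Ioo (-ε) ε) := contDiff_fst.comp_contDiffOn hsm
  have h0 : (0 : ℝ) ∈ Ioo (-ε) ε := ⟨by linarith, hε⟩
  have hd0 : deriv c 0 = v₀ := by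
    rw [(hcd 0 h0).deriv]
    simp only [hc, hz0]
    exact hleft _ hy₀ _
  have hc0 : c 0 = y₀ := by simp [hc, hz0]
  have hBdiff : ∀ y ∈ O, HasFDerivAt B (fderiv ℝ B y) y := fun y hy =>
    (((hB y hy).contDiffAt (hO.mem_nhds hy)).differentiableAt (by simp)).hasFDerivAt
  have hfd : ∀ y ∈ O, ∀ u w, fderiv ℝ (fun y => B y u u) y w = fderiv ℝ B y w u u := by
    intro y hy u w
    have := ((hBdiff y hy).clm_apply (hasFDerivAt_const u y)).clm_apply (hasFDerivAt_const u y)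
    rw [this.fderiv]
    simp
  have hgeo : ∀ s ∈ Ioo (-ε) ε, ∀ w, HasDerivAt (fun r => B (c r) (deriv c r) w)
      ((1 / 2 : ℝ) * fderiv ℝ B (c s) w (deriv c s) (deriv c s)) s := by
    intro s hs w
    have h := (hpd s hs).clm_apply (hasDerivAt_const s w)
    have he : (fun r => B (c r) (deriv c r) w) =ᶠ[𝓝 s] fun r => (z r).2 w := by
      filter_upwards [isOpen_Ioo.mem_nhds hs] with r hr
      rw [hp r hr]
    refine (h.congr_of_eventuallyEq he).congr_deriv ?_
    rw [(hcd s hs).deriv]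
    simp [hamiltonianField, hc]
  have hdd : ∀ s ∈ Ioo (-ε) ε, HasDerivAt (deriv c) (deriv (deriv c) s) s := fun s hs =>
    ((((contDiffOn_infty_iff_deriv_of_isOpen isOpen_Ioo).1 hcsm).2 s hs).contDiffAt
      (isOpen_Ioo.mem_nhds hs)).differentiableAt (by simp) |>.hasDerivAt
  have hen : ∀ s ∈ Ioo (-ε) ε,
      HasDerivAt (fun r => B (c r) (deriv c r) (deriv c r)) 0 s := by
    intro s hs
    have hcs : HasDerivAt c (deriv c s) s := (hcd s hs).differentiableAt.hasDerivAt
    have hBc : HasDerivAt (fun r => B (c r)) (fderiv ℝ B (c s) (deriv c s)) s :=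
      (hBdiff _ (hcO s hs)).comp_hasDerivAt s hcs
    have h1 := (hBc.clm_apply (hdd s hs)).clm_apply (hdd s hs)
    -- With the last argument frozen at `ċ(s)`, the product rule and the geodesic equation give
    -- `B(c̈, ċ) = -(1/2) dB(ċ)(ċ, ċ)`. By symmetry the two such terms cancel `dB(ċ)(ċ, ċ)` in the
    -- derivative of the energy.
    have h2 := ((hBc.clm_apply (hdd s hs)).clm_apply (hasDerivAt_const s (deriv c s))).unique
      (hgeo s hs (deriv c s))
    refine h1.congr_deriv ?_
    simp only [add_apply, map_zero, add_zero] at h2 ⊢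
    rw [hsymm _ (hcO s hs) (deriv c s) (deriv (deriv c) s)]
    linarith
  have hconst : ∀ s ∈ Ioo (-ε) ε, B (c s) (deriv c s) (deriv c s) = B y₀ v₀ v₀ := by
    intro s hs
    have := isOpen_Ioo.is_const_of_deriv_eq_zero (isPreconnected_Ioo (a := -ε) (b := ε))
      (fun r hr => (hen r hr).differentiableAt.differentiableWithinAt)
      (fun r hr => (hen r hr).deriv) hs h0
    rw [this, hc0, hd0]
  -- Conservation of energy does not exclude a vanishing velocity when the energy is zero, so the
  -- interval is shrunk by continuity.
  have hne : ∀ᶠ s in 𝓝 (0 : ℝ), deriv c s ≠ 0 :=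
    (hdd 0 h0).continuousAt.eventually_ne (hd0 ▸ hv₀)
  obtain ⟨δ, hδ, hδne⟩ := Metric.eventually_nhds_iff.1 hne
  have hsub : Ioo (-min ε δ) (min ε δ) ⊆ Ioo (-ε) ε :=
    Ioo_subset_Ioo (neg_le_neg (min_le_left _ _)) (min_le_left _ _)
  refine ⟨c, min ε δ, lt_min hε hδ, hc0, hd0, hcsm.mono hsub, fun s hs => ⟨hcO s (hsub hs),
    hδne ?_, hconst s (hsub hs), fun w => ?_⟩⟩
  · rw [Real.dist_eq, sub_zero, abs_lt]
    exact ⟨by linarith [hs.1, min_le_right ε δ], by linarith [hs.2, min_le_right ε δ]⟩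
  · rw [hfd _ (hcO s (hsub hs))]
    exact hgeo s (hsub hs) w

end LocalGeodesic

/-! ## The spacetime metric in local coordinates -/

namespace ElectrostaticSystem

variable {n : ℕ} {M : Type*} [TopologicalSpace M]
  [ChartedSpace (EuclideanSpace ℝ (Fin n)) M] [IsManifold (𝓡 n) ∞ M]
  (S : ElectrostaticSystem n M)

/-- The differential of the inverse of the chart of `M` at `x`. -/
noncomputable def chartFrame (x : M) (y : EuclideanSpace ℝ (Fin n)) :
    EuclideanSpace ℝ (Fin n) →L[ℝ] EuclideanSpace ℝ (Fin n) :=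
  mfderivWithin 𝓘(ℝ, EuclideanSpace ℝ (Fin n)) (𝓡 n) (extChartAt (𝓡 n) x).symm (range (𝓡 n)) y

/-- The Riemannian metric at a point, as a bilinear form on the model space. -/
noncomputable def metricAt (p : M) :
    EuclideanSpace ℝ (Fin n) →L[ℝ] EuclideanSpace ℝ (Fin n) →L[ℝ] ℝ :=
  S.metric.inner p

theorem metricAt_symm (p : M) (v w : EuclideanSpace ℝ (Fin n)) :
    S.metricAt p v w = S.metricAt p w v :=
  S.metric.symm p v w

theorem metricAt_pos (p : M) {v : EuclideanSpace ℝ (Fin n)} (hv : v ≠ 0) :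
    0 < S.metricAt p v v :=
  S.metric.pos p v hv

/-- The Riemannian metric in the chart of `M` at `x`. -/
noncomputable def metricInChart (x : M) (y : EuclideanSpace ℝ (Fin n)) :
    EuclideanSpace ℝ (Fin n) →L[ℝ] EuclideanSpace ℝ (Fin n) →L[ℝ] ℝ :=
  (S.metricAt ((extChartAt (𝓡 n) x).symm y)).bilinearComp (chartFrame x y) (chartFrame x y)

theorem one_le_infty : (1 : WithTop ℕ∞) ≤ ∞ := by exact_mod_cast le_top

theorem isManifold_one : IsManifold (𝓡 n) 1 M := IsManifold.of_le one_le_infty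

/-- Each coefficient is the smooth bundle metric evaluated on two smooth fields along the inverse
chart, namely the images of constant vectors under its tangent map. -/
theorem contDiffOn_metricInChart (x : M) :
    ContDiffOn ℝ ∞ (S.metricInChart x) (extChartAt (𝓡 n) x).target := by
  rw [contDiffOn_clm_apply]
  intro v
  rw [contDiffOn_clm_apply]
  intro w
  have hsymm : ContMDiffOn 𝓘(ℝ, EuclideanSpace ℝ (Fin n)) (𝓡 n) ∞ (extChartAt (𝓡 n) x).symm
      (extChartAt (𝓡 n) x).target := contMDiffOn_extChartAt_symm x
  have hsec : ∀ v : EuclideanSpace ℝ (Fin n),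
      ContMDiffOn 𝓘(ℝ, EuclideanSpace ℝ (Fin n)) (𝓡 n).tangent ∞
      (fun y => (⟨(extChartAt (𝓡 n) x).symm y, chartFrame x y v⟩ : TangentBundle (𝓡 n) M))
      (extChartAt (𝓡 n) x).target := by
    intro v
    have h1 := hsymm.contMDiffOn_tangentMapWithin (m := ∞) (by simp)
      (isOpen_extChartAt_target x).uniqueMDiffOn
    have h2 : ContMDiffOn 𝓘(ℝ, EuclideanSpace ℝ (Fin n))
        (𝓘(ℝ, EuclideanSpace ℝ (Fin n))).tangent ∞
        (fun y => (⟨y, v⟩ : TangentBundle 𝓘(ℝ, EuclideanSpace ℝ (Fin n))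
          (EuclideanSpace ℝ (Fin n)))) (extChartAt (𝓡 n) x).target :=
      contMDiffOn_vectorSpace_iff_contDiffOn.2 contDiffOn_const
    refine (h1.comp h2 fun y hy => hy).congr fun y hy => ?_
    simp only [tangentMapWithin, Function.comp, chartFrame]
    rw [mfderivWithin_of_isOpen (isOpen_extChartAt_target x) hy, ModelWithCorners.range_eq_univ,
      mfderivWithin_univ]
    rfl
  have h := ContMDiffOn.clm_bundle_apply₂
    (F₁ := EuclideanSpace ℝ (Fin n)) (F₂ := EuclideanSpace ℝ (Fin n)) (F₃ := ℝ)
    (E₁ := fun x : M => TangentSpace (𝓡 n) x) (E₂ := fun x : M => TangentSpace (𝓡 n) x)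
    (E₃ := Bundle.Trivial M ℝ) (b := (extChartAt (𝓡 n) x).symm)
    (ψ := fun y => S.metric.inner ((extChartAt (𝓡 n) x).symm y))
    (S.metric.contMDiff.comp_contMDiffOn hsymm) (hsec v) (hsec w)
  rw [← contMDiffOn_iff_contDiffOn]
  intro y hy
  exact ((Bundle.contMDiffWithinAt_totalSpace).1 (h y hy)).2

/-- The Lorentzian metric in the chart of the spacetime at `x₀`. -/
noncomputable def lorentzInChart (x₀ : ℝ × M) (z : ℝ × EuclideanSpace ℝ (Fin n)) :
    (ℝ × EuclideanSpace ℝ (Fin n)) →L[ℝ] (ℝ × EuclideanSpace ℝ (Fin n)) →L[ℝ] ℝ :=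
  (-(S.lapse ((extChartAt (𝓡 n) x₀.2).symm z.2)) ^ 2) •
    ((ContinuousLinearMap.mul ℝ ℝ).bilinearComp
      (ContinuousLinearMap.fst ℝ ℝ (EuclideanSpace ℝ (Fin n)))
      (ContinuousLinearMap.fst ℝ ℝ (EuclideanSpace ℝ (Fin n)))) +
    (S.metricInChart x₀.2 z.2).bilinearComp
      (ContinuousLinearMap.snd ℝ ℝ (EuclideanSpace ℝ (Fin n)))
      (ContinuousLinearMap.snd ℝ ℝ (EuclideanSpace ℝ (Fin n)))

theorem lorentzInChart_apply (x₀ : ℝ × M) (z v w : ℝ × EuclideanSpace ℝ (Fin n)) :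
    S.lorentzInChart x₀ z v w = -(S.lapse ((extChartAt (𝓡 n) x₀.2).symm z.2)) ^ 2 * (v.1 * w.1)
      + S.metricAt ((extChartAt (𝓡 n) x₀.2).symm z.2)
        (chartFrame x₀.2 z.2 v.2) (chartFrame x₀.2 z.2 w.2) := by
  rfl

theorem extChartAt_spacetime (x₀ : ℝ × M) (p : ℝ × M) :
    extChartAt (spacetimeModel n) x₀ p = (p.1, extChartAt (𝓡 n) x₀.2 p.2) := by
  rw [extChartAt_prod]
  simp [chartAt_self_eq]

theorem extChartAt_spacetime_symm (x₀ : ℝ × M) (z : ℝ × EuclideanSpace ℝ (Fin n)) :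
    (extChartAt (spacetimeModel n) x₀).symm z = (z.1, (extChartAt (𝓡 n) x₀.2).symm z.2) := by
  rw [extChartAt_prod]
  simp [chartAt_self_eq]

theorem mem_target_spacetime {x₀ : ℝ × M} {z : ℝ × EuclideanSpace ℝ (Fin n)} :
    z ∈ (extChartAt (spacetimeModel n) x₀).target ↔ z.2 ∈ (extChartAt (𝓡 n) x₀.2).target := by
  rw [extChartAt_prod]
  simp [chartAt_self_eq]

theorem mem_source_spacetime {x₀ : ℝ × M} {p : ℝ × M} :
    p ∈ (extChartAt (spacetimeModel n) x₀).source ↔ p.2 ∈ (extChartAt (𝓡 n) x₀.2).source := by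
  rw [extChartAt_prod]
  simp [chartAt_self_eq]

theorem range_spacetimeModel : range (spacetimeModel n) = univ :=
  ModelWithCorners.range_eq_univ _

theorem hasMFDerivAt_extChartAt_spacetime_symm {x₀ : ℝ × M}
    {z : ℝ × EuclideanSpace ℝ (Fin n)} (hz : z ∈ (extChartAt (spacetimeModel n) x₀).target) :
    HasMFDerivAt 𝓘(ℝ, ℝ × EuclideanSpace ℝ (Fin n)) (spacetimeModel n)
      (extChartAt (spacetimeModel n) x₀).symm z
      ((ContinuousLinearMap.fst ℝ ℝ (EuclideanSpace ℝ (Fin n))).prod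
        ((chartFrame x₀.2 z.2).comp (ContinuousLinearMap.snd ℝ ℝ (EuclideanSpace ℝ (Fin n))))) := by
  have : IsManifold (𝓡 n) 1 M := isManifold_one
  have h1 : HasMFDerivAt 𝓘(ℝ, ℝ × EuclideanSpace ℝ (Fin n)) 𝓘(ℝ, ℝ)
      (fun z : ℝ × EuclideanSpace ℝ (Fin n) => z.1) z
      (ContinuousLinearMap.fst ℝ ℝ (EuclideanSpace ℝ (Fin n))) :=
    hasFDerivAt_fst.hasMFDerivAt
  have h2 : HasMFDerivAt 𝓘(ℝ, ℝ × EuclideanSpace ℝ (Fin n)) 𝓘(ℝ, EuclideanSpace ℝ (Fin n))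
      (fun z : ℝ × EuclideanSpace ℝ (Fin n) => z.2) z
      (ContinuousLinearMap.snd ℝ ℝ (EuclideanSpace ℝ (Fin n))) :=
    hasFDerivAt_snd.hasMFDerivAt
  have h3 : HasMFDerivAt 𝓘(ℝ, EuclideanSpace ℝ (Fin n)) (𝓡 n) (extChartAt (𝓡 n) x₀.2).symm z.2
      (chartFrame x₀.2 z.2) := by
    have := mdifferentiableWithinAt_extChartAt_symm (mem_target_spacetime.1 hz)
    have h4 := this.hasMFDerivWithinAt
    rw [ModelWithCorners.range_eq_univ, hasMFDerivWithinAt_univ] at h4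
    simpa [chartFrame] using h4
  have := h1.prodMk (h3.comp z h2)
  refine this.congr_of_eventuallyEq (Eventually.of_forall fun z => ?_)
  exact extChartAt_spacetime_symm x₀ z

theorem localForm_lorentzMetric {x₀ : ℝ × M} {z : ℝ × EuclideanSpace ℝ (Fin n)}
    (hz : z ∈ (extChartAt (spacetimeModel n) x₀).target) (v w : ℝ × EuclideanSpace ℝ (Fin n)) :
    localForm (spacetimeModel n) S.lorentzMetric x₀ z v w = S.lorentzInChart x₀ z v w := by
  rw [localForm, range_spacetimeModel, mfderivWithin_univ,
    (hasMFDerivAt_extChartAt_spacetime_symm hz).mfderiv, lorentzInChart_apply]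
  have h := extChartAt_spacetime_symm x₀ z
  have h2 : ((extChartAt (spacetimeModel n) x₀).symm z).2 = (extChartAt (𝓡 n) x₀.2).symm z.2 := by
    rw [h]
  unfold lorentzMetric
  rw [h2]
  rfl

theorem contDiffOn_lorentzInChart (x₀ : ℝ × M) :
    ContDiffOn ℝ ∞ (S.lorentzInChart x₀) (extChartAt (spacetimeModel n) x₀).target := by
  have hmaps : MapsTo (fun z : ℝ × EuclideanSpace ℝ (Fin n) => z.2)
      (extChartAt (spacetimeModel n) x₀).target (extChartAt (𝓡 n) x₀.2).target :=
    fun z hz => mem_target_spacetime.1 hz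
  have hN : ContDiffOn ℝ ∞ (fun y => S.lapse ((extChartAt (𝓡 n) x₀.2).symm y))
      (extChartAt (𝓡 n) x₀.2).target :=
    contMDiffOn_iff_contDiffOn.1
      (S.lapse_smooth.comp_contMDiffOn (contMDiffOn_extChartAt_symm x₀.2))
  have hsnd : ContDiffOn ℝ ∞ (fun z : ℝ × EuclideanSpace ℝ (Fin n) => z.2)
      (extChartAt (spacetimeModel n) x₀).target := contDiffOn_snd
  rw [contDiffOn_clm_apply]
  intro v
  rw [contDiffOn_clm_apply]
  intro w
  have h1 := ((hN.comp hsnd hmaps).pow 2).neg.mul (contDiffOn_const (c := v.1 * w.1))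
  have h2 := (((S.contDiffOn_metricInChart x₀.2).comp hsnd hmaps).clm_apply
    (contDiffOn_const (c := v.2))).clm_apply (contDiffOn_const (c := w.2))
  exact h1.add h2

theorem lorentzInChart_symm (x₀ : ℝ × M) (z v w : ℝ × EuclideanSpace ℝ (Fin n)) :
    S.lorentzInChart x₀ z v w = S.lorentzInChart x₀ z w v := by
  rw [lorentzInChart_apply, lorentzInChart_apply, S.metricAt_symm, mul_comm v.1]

theorem chartFrame_injective {x : M} {y : EuclideanSpace ℝ (Fin n)}
    (hy : y ∈ (extChartAt (𝓡 n) x).target) {v : EuclideanSpace ℝ (Fin n)}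
    (h : chartFrame x y v = 0) : v = 0 := by
  have : IsManifold (𝓡 n) 1 M := isManifold_one
  have := isInvertible_mfderivWithin_extChartAt_symm hy
  exact (this.injective) (h.trans (map_zero _).symm)

/-- Pairing `v` with its time reflection `(-v₁, v₂)` turns the Lorentzian form into the positive
definite `N² v₁² + g(v₂, v₂)`. -/
theorem lorentzInChart_nondegenerate {x₀ : ℝ × M} {z : ℝ × EuclideanSpace ℝ (Fin n)}
    (hz : z ∈ (extChartAt (spacetimeModel n) x₀).target) (v : ℝ × EuclideanSpace ℝ (Fin n))
    (h : S.lorentzInChart x₀ z v = 0) : v = 0 := by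
  have h1 : S.lorentzInChart x₀ z v (-v.1, v.2) = 0 := by rw [h]; rfl
  rw [lorentzInChart_apply] at h1
  simp only at h1
  have hN := S.lapse_pos ((extChartAt (𝓡 n) x₀.2).symm z.2)
  have h2 : v.2 = 0 := by
    by_contra hv
    have := S.metricAt_pos ((extChartAt (𝓡 n) x₀.2).symm z.2) (v := chartFrame x₀.2 z.2 v.2)
      (fun h0 => hv (chartFrame_injective (mem_target_spacetime.1 hz) h0))
    nlinarith [sq_nonneg (S.lapse ((extChartAt (𝓡 n) x₀.2).symm z.2) * v.1)]
  rw [h2] at h1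
  simp only [map_zero, add_zero] at h1
  have h3 : v.1 = 0 := by
    have : (S.lapse ((extChartAt (𝓡 n) x₀.2).symm z.2) * v.1) ^ 2 = 0 := by nlinarith
    rcases mul_eq_zero.1 (pow_eq_zero_iff (two_ne_zero) |>.1 this) with h | h
    · exact absurd h hN.ne'
    · exact h
  exact Prod.ext h3 h2

end ElectrostaticSystem

namespace ElectrostaticSystem

variable {n : ℕ} {M : Type*} [TopologicalSpace M]
  [ChartedSpace (EuclideanSpace ℝ (Fin n)) M] [IsManifold (𝓡 n) ∞ M]
  (S : ElectrostaticSystem n M)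

/-! ## Existence of null geodesics -/

/-- `localForm` agrees with the bundled form `lorentzInChart` only on the chart target. This target
is open, so derivatives at its points do not see the difference. -/
theorem geodesicEquationAt_iff {x₀ : ℝ × M} {γ : ℝ → ℝ × M} {s : ℝ} (hγ : ContinuousAt γ s)
    (hs : γ s ∈ (extChartAt (spacetimeModel n) x₀).source) :
    GeodesicEquationAt (spacetimeModel n) S.lorentzMetric x₀ γ s ↔
      ∀ w, HasDerivAt (fun r => S.lorentzInChart x₀ (extChartAt (spacetimeModel n) x₀ (γ r))
          (deriv (fun r => extChartAt (spacetimeModel n) x₀ (γ r)) r) w)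
        ((1 / 2 : ℝ) * fderiv ℝ (fun y => S.lorentzInChart x₀ y
          (deriv (fun r => extChartAt (spacetimeModel n) x₀ (γ r)) s)
          (deriv (fun r => extChartAt (spacetimeModel n) x₀ (γ r)) s))
          (extChartAt (spacetimeModel n) x₀ (γ s)) w) s := by
  have htar : extChartAt (spacetimeModel n) x₀ (γ s) ∈ (extChartAt (spacetimeModel n) x₀).target :=
    (extChartAt (spacetimeModel n) x₀).map_source hs
  have hev : ∀ᶠ r in 𝓝 s, extChartAt (spacetimeModel n) x₀ (γ r) ∈
      (extChartAt (spacetimeModel n) x₀).target := by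
    filter_upwards [hγ ((isOpen_extChartAt_source x₀).mem_nhds hs)] with r hr
    exact (extChartAt (spacetimeModel n) x₀).map_source hr
  refine forall_congr' fun w => ?_
  have h1 : (fun r => localForm (spacetimeModel n) S.lorentzMetric x₀
      (extChartAt (spacetimeModel n) x₀ (γ r))
      (deriv (fun r => extChartAt (spacetimeModel n) x₀ (γ r)) r) w) =ᶠ[𝓝 s]
      (fun r => S.lorentzInChart x₀ (extChartAt (spacetimeModel n) x₀ (γ r))
          (deriv (fun r => extChartAt (spacetimeModel n) x₀ (γ r)) r) w) := by
    filter_upwards [hev] with r hr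
    exact S.localForm_lorentzMetric hr _ _
  have h2 : ∀ v : ℝ × EuclideanSpace ℝ (Fin n),
      fderivWithin ℝ (fun y => localForm (spacetimeModel n) S.lorentzMetric x₀ y v v)
      (range (spacetimeModel n)) (extChartAt (spacetimeModel n) x₀ (γ s)) =
      fderiv ℝ (fun y => S.lorentzInChart x₀ y v v)
        (extChartAt (spacetimeModel n) x₀ (γ s)) := by
    intro v
    rw [range_spacetimeModel, fderivWithin_univ]
    apply Filter.EventuallyEq.fderiv_eq
    filter_upwards [(isOpen_extChartAt_target x₀).mem_nhds htar] with y hy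
    exact S.localForm_lorentzMetric hy _ _
  rw [h2, h1.hasDerivAt_iff]

theorem chartFrame_self (x : M) :
    chartFrame x (extChartAt (𝓡 n) x x) =
      ContinuousLinearMap.id ℝ (EuclideanSpace ℝ (Fin n)) := by
  have : IsManifold (𝓡 n) 1 M := isManifold_one
  exact mfderivWithin_range_extChartAt_symm

theorem lorentzInChart_self (p : ℝ × M) (v w : ℝ × EuclideanSpace ℝ (Fin n)) :
    S.lorentzInChart p (extChartAt (spacetimeModel n) p p) v w = S.lorentzMetric p v w := by
  rw [lorentzInChart_apply, extChartAt_spacetime]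
  simp only
  rw [chartFrame_self, (extChartAt (𝓡 n) p.2).left_inv (mem_extChartAt_source p.2)]
  rfl

/-- Through each point there is a null geodesic with any prescribed null velocity. -/
theorem exists_nullGeodesic (p : ℝ × M) (v : ℝ × EuclideanSpace ℝ (Fin n)) (hv : v ≠ 0)
    (hnull : S.lorentzMetric p v v = 0) :
    ∃ (γ : ℝ → ℝ × M) (J : Set ℝ), IsNullGeodesicOn (spacetimeModel n) S.lorentzMetric γ J ∧
      0 ∈ J ∧ γ 0 = p ∧ velocity (spacetimeModel n) γ 0 = v := by
  have hO : IsOpen (extChartAt (spacetimeModel n) p).target := isOpen_extChartAt_target p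
  obtain ⟨c, ε, hε, hc0, hd0, hsm, hc⟩ := exists_local_geodesic hO
    (S.contDiffOn_lorentzInChart p) (fun y hy v => S.lorentzInChart_nondegenerate hy v)
    (fun y _ => S.lorentzInChart_symm p y) (mem_extChartAt_target p) hv
  have h0 : (0 : ℝ) ∈ Ioo (-ε) ε := ⟨by linarith, hε⟩
  have hvel : ∀ s ∈ Ioo (-ε) ε,
      velocity (spacetimeModel n) (fun r => (extChartAt (spacetimeModel n) p).symm (c r)) s =
      ((deriv c s).1, chartFrame p.2 (c s).2 (deriv c s).2) := by
    intro s hs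
    have hd : HasDerivAt c (deriv c s) s :=
      ((hsm s hs).contDiffAt (isOpen_Ioo.mem_nhds hs)).differentiableAt (by simp) |>.hasDerivAt
    have h := (hasMFDerivAt_extChartAt_spacetime_symm (hc s hs).1).comp s
      hd.hasFDerivAt.hasMFDerivAt
    rw [velocity]
    erw [h.mfderiv]
    change (((1 : ℝ) • deriv c s).1, chartFrame p.2 (c s).2 ((1 : ℝ) • deriv c s).2) = _
    rw [one_smul]
  refine ⟨fun r => (extChartAt (spacetimeModel n) p).symm (c r), Ioo (-ε) ε,
    ⟨⟨isOpen_Ioo, ordConnected_Ioo, ?_, ?_⟩, ?_, ?_⟩, h0, ?_, ?_⟩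
  · exact (contMDiffOn_extChartAt_symm p).comp hsm.contMDiffOn fun s hs => (hc s hs).1
  · intro s hs
    have hsrc : (extChartAt (spacetimeModel n) p).symm (c s) ∈
        (extChartAt (spacetimeModel n) p).source :=
      (extChartAt (spacetimeModel n) p).map_target (hc s hs).1
    have hcont : ContinuousAt (fun r => (extChartAt (spacetimeModel n) p).symm (c r)) s :=
      ContinuousAt.comp (g := (extChartAt (spacetimeModel n) p).symm)
        (continuousAt_extChartAt_symm'' (hc s hs).1)
        ((hsm.continuousOn s hs).continuousAt (isOpen_Ioo.mem_nhds hs))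
    refine ⟨p, ?_, (S.geodesicEquationAt_iff hcont hsrc).2 fun w => ?_⟩
    · rwa [← extChartAt_source (spacetimeModel n)]
    · have he : ∀ r ∈ Ioo (-ε) ε, extChartAt (spacetimeModel n) p
          ((extChartAt (spacetimeModel n) p).symm (c r)) = c r := fun r hr =>
        (extChartAt (spacetimeModel n) p).right_inv (hc r hr).1
      have hde : ∀ r ∈ Ioo (-ε) ε, deriv (fun r => extChartAt (spacetimeModel n) p
          ((extChartAt (spacetimeModel n) p).symm (c r))) r = deriv c r := fun r hr => by
        apply Filter.EventuallyEq.deriv_eq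
        filter_upwards [isOpen_Ioo.mem_nhds hr] with r hr using he r hr
      rw [hde s hs, he s hs]
      refine ((hc s hs).2.2.2 w).congr_of_eventuallyEq ?_
      filter_upwards [isOpen_Ioo.mem_nhds hs] with r hr
      rw [hde r hr, he r hr]
  · intro s hs h
    rw [hvel s hs] at h
    have h1 : (deriv c s).1 = 0 := congrArg Prod.fst h
    have h2 : chartFrame p.2 (c s).2 (deriv c s).2 = 0 := congrArg Prod.snd h
    exact (hc s hs).2.1 (Prod.ext h1
      (chartFrame_injective (mem_target_spacetime.1 (hc s hs).1) h2))
  · intro s hs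
    have h := (hc s hs).2.2.1
    rw [lorentzInChart_self, hnull, lorentzInChart_apply] at h
    rw [hvel s hs, ← h]
    simp only [lorentzMetric, extChartAt_spacetime_symm]
    rfl
  · simp only [hc0]
    exact (extChartAt (spacetimeModel n) p).left_inv (mem_extChartAt_source p)
  · rw [hvel 0 h0, hd0, hc0, extChartAt_spacetime]
    simp only
    rw [chartFrame_self]
    rfl

/-! ## Time reflections -/

/-- The reflection of the spacetime about the time `a`. -/
def reflect {Y : Type*} (a : ℝ) (p : ℝ × Y) : ℝ × Y := (2 * a - p.1, p.2)

theorem continuous_reflect {Y : Type*} [TopologicalSpace Y] (a : ℝ) :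
    Continuous (reflect a : ℝ × Y → ℝ × Y) := by
  unfold reflect
  fun_prop

/-- The linear part of a time reflection. -/
noncomputable def flipTime (n : ℕ) :
    (ℝ × EuclideanSpace ℝ (Fin n)) ≃L[ℝ] (ℝ × EuclideanSpace ℝ (Fin n)) :=
  (ContinuousLinearEquiv.neg ℝ).prodCongr (ContinuousLinearEquiv.refl ℝ _)

@[simp] theorem flipTime_apply (v : ℝ × EuclideanSpace ℝ (Fin n)) :
    flipTime n v = (-v.1, v.2) := rfl

theorem reflect_eq (a : ℝ) (z : ℝ × EuclideanSpace ℝ (Fin n)) :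
    reflect a z = flipTime n z + (2 * a, 0) := by
  ext1 <;> simp [reflect]
  ring

theorem hasMFDerivAt_reflect (a : ℝ) (p : ℝ × M) :
    HasMFDerivAt (spacetimeModel n) (spacetimeModel n) (reflect a) p
      (flipTime n).toContinuousLinearMap := by
  have h1 : HasMFDerivAt (spacetimeModel n) 𝓘(ℝ, ℝ) (fun p : ℝ × M => 2 * a - p.1) p
      (-(ContinuousLinearMap.fst ℝ ℝ (EuclideanSpace ℝ (Fin n)))) := by
    have h : HasMFDerivAt 𝓘(ℝ, ℝ) 𝓘(ℝ, ℝ) (fun t : ℝ => 2 * a - t) p.1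
        (-ContinuousLinearMap.id ℝ ℝ) :=
      ((hasFDerivAt_id p.1).const_sub (2 * a)).hasMFDerivAt
    exact h.comp p (hasMFDerivAt_fst p)
  exact h1.prodMk (hasMFDerivAt_snd p)

theorem contMDiff_reflect (a : ℝ) :
    ContMDiff (spacetimeModel n) (spacetimeModel n) ∞ (reflect a : ℝ × M → ℝ × M) := by
  have h1 : ContMDiff 𝓘(ℝ, ℝ) 𝓘(ℝ, ℝ) ∞ (fun t : ℝ => 2 * a - t) :=
    (contDiff_const.sub contDiff_id).contMDiff
  exact (h1.comp contMDiff_fst).prodMk contMDiff_snd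

/-- The coefficients are independent of time and have no mixed time-space terms. -/
theorem lorentzInChart_flipTime (x₀ : ℝ × M) (a : ℝ) (z v w : ℝ × EuclideanSpace ℝ (Fin n)) :
    S.lorentzInChart x₀ (reflect a z) (flipTime n v) w =
      S.lorentzInChart x₀ z v (flipTime n w) := by
  simp [lorentzInChart_apply, reflect]

theorem lorentzMetric_flipTime (a : ℝ) (p : ℝ × M) (v w : ℝ × EuclideanSpace ℝ (Fin n)) :
    S.lorentzMetric (reflect a p) (flipTime n v) (flipTime n w) = S.lorentzMetric p v w := by
  change -(S.lapse p.2) ^ 2 * (-v.1 * -w.1) + _ = -(S.lapse p.2) ^ 2 * (v.1 * w.1) + _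
  rw [neg_mul_neg]
  rfl

theorem mdifferentiableAt_of_isGeodesicOn {γ : ℝ → ℝ × M} {J : Set ℝ}
    (h : IsGeodesicOn (spacetimeModel n) S.lorentzMetric γ J) {s : ℝ} (hs : s ∈ J) :
    MDifferentiableAt 𝓘(ℝ, ℝ) (spacetimeModel n) γ s :=
  ((h.smooth s hs).contMDiffAt (h.isOpen.mem_nhds hs)).mdifferentiableAt (by simp)

theorem velocity_reflect_shift {γ : ℝ → ℝ × M} (a s₀ : ℝ) {s : ℝ}
    (h : MDifferentiableAt 𝓘(ℝ, ℝ) (spacetimeModel n) γ (s + s₀)) :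
    velocity (spacetimeModel n) (fun r => reflect a (γ (r + s₀))) s =
      flipTime n (velocity (spacetimeModel n) γ (s + s₀)) := by
  have h1 : HasMFDerivAt 𝓘(ℝ, ℝ) 𝓘(ℝ, ℝ) (fun r : ℝ => r + s₀) s (ContinuousLinearMap.id ℝ ℝ) :=
    ((hasFDerivAt_id s).add_const s₀).hasMFDerivAt
  have h2 := (hasMFDerivAt_reflect a (γ (s + s₀))).comp s
    (HasMFDerivAt.comp (g := γ) s h.hasMFDerivAt h1)
  rw [velocity]
  erw [h2.mfderiv]
  rfl

/-- Time reflections and shifts of the parameter map null geodesics to null geodesics. -/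
theorem IsNullGeodesicOn.reflect_shift {γ : ℝ → ℝ × M} {J : Set ℝ}
    (h : IsNullGeodesicOn (spacetimeModel n) S.lorentzMetric γ J) (a s₀ : ℝ) :
    IsNullGeodesicOn (spacetimeModel n) S.lorentzMetric (fun r => reflect a (γ (r + s₀)))
      ((fun r => r + s₀) ⁻¹' J) := by
  have hvel : ∀ s ∈ (fun r => r + s₀) ⁻¹' J,
      velocity (spacetimeModel n) (fun r => reflect a (γ (r + s₀))) s =
      flipTime n (velocity (spacetimeModel n) γ (s + s₀)) := fun s hs =>
    velocity_reflect_shift a s₀ (S.mdifferentiableAt_of_isGeodesicOn h.toIsGeodesicOn hs)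
  refine ⟨⟨h.isOpen.preimage (by fun_prop), ?_, ?_, ?_⟩, ?_, ?_⟩
  · exact h.ordConnected.preimage_mono fun x y hxy => by simpa using hxy
  · have h1 : ContMDiffOn 𝓘(ℝ, ℝ) 𝓘(ℝ, ℝ) ∞ (fun r : ℝ => r + s₀) ((fun r => r + s₀) ⁻¹' J) :=
      (contDiff_id.add contDiff_const).contMDiff.contMDiffOn
    exact (contMDiff_reflect a).comp_contMDiffOn (h.smooth.comp h1 fun s hs => hs)
  · intro s hs
    obtain ⟨x₀, hx₀, heq⟩ := h.equation _ hs
    rw [← extChartAt_source (spacetimeModel n)] at hx₀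
    have hcγ : ContinuousAt γ (s + s₀) :=
      (S.mdifferentiableAt_of_isGeodesicOn h.toIsGeodesicOn hs).continuousAt
    have hc : ContinuousAt (fun r => reflect a (γ (r + s₀))) s :=
      (continuous_reflect a).continuousAt.comp
        (ContinuousAt.comp (g := γ) hcγ (by fun_prop))
    have hsrc : reflect a (γ (s + s₀)) ∈ (extChartAt (spacetimeModel n) x₀).source :=
      mem_source_spacetime.2 (mem_source_spacetime.1 hx₀ :)
    refine ⟨x₀, by rwa [← extChartAt_source (spacetimeModel n)], ?_⟩
    rw [S.geodesicEquationAt_iff hcγ hx₀] at heq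
    rw [S.geodesicEquationAt_iff hc hsrc]
    have he : ∀ r, extChartAt (spacetimeModel n) x₀ (reflect a (γ (r + s₀))) =
        reflect a (extChartAt (spacetimeModel n) x₀ (γ (r + s₀))) := fun r => by
      simp only [extChartAt_spacetime, reflect]
    have hd : ∀ r, deriv (fun r => reflect a (extChartAt (spacetimeModel n) x₀ (γ (r + s₀)))) r =
        flipTime n (deriv (fun r => extChartAt (spacetimeModel n) x₀ (γ r)) (r + s₀)) := by
      intro r
      simp only [reflect_eq, deriv_add_const]
      rw [← fderiv_apply_one_eq_deriv]
      have := (flipTime n).comp_fderiv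
        (f := fun r => extChartAt (spacetimeModel n) x₀ (γ (r + s₀))) (x := r)
      have h2 : (fun r => flipTime n (extChartAt (spacetimeModel n) x₀ (γ (r + s₀)))) =
        (flipTime n) ∘ fun r => extChartAt (spacetimeModel n) x₀ (γ (r + s₀)) := rfl
      rw [h2, this]
      simp only [ContinuousLinearMap.comp_apply, fderiv_apply_one_eq_deriv,
        ContinuousLinearEquiv.coe_coe]
      rw [deriv_comp_add_const (fun r => extChartAt (spacetimeModel n) x₀ (γ r))]
    intro w
    simp only [he, hd, S.lorentzInChart_flipTime]
    -- The energy is even in the time component of the velocity and invariant under the reflection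
    -- of the base point; the chain rule transfers the latter to its derivative.
    have hfd : ∀ v z : ℝ × EuclideanSpace ℝ (Fin n),
        fderiv ℝ (fun y => S.lorentzInChart x₀ y (flipTime n v) (flipTime n v)) (reflect a z) w =
        fderiv ℝ (fun y => S.lorentzInChart x₀ y v v) z (flipTime n w) := by
      intro v z
      have h1 : (fun y => S.lorentzInChart x₀ y (flipTime n v) (flipTime n v)) =
          fun y => S.lorentzInChart x₀ y v v := by
        ext y; simp [lorentzInChart_apply]
      have h2 : (fun y => S.lorentzInChart x₀ y v v) =
          (fun y => S.lorentzInChart x₀ (y + (2 * a, 0)) v v) ∘ flipTime n := by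
        ext y; simp [lorentzInChart_apply]
      rw [h1]
      conv_rhs => rw [h2, (flipTime n).comp_right_fderiv]
      rw [ContinuousLinearMap.comp_apply,
        fderiv_comp_add_right (f := fun y => S.lorentzInChart x₀ y v v), ← reflect_eq]
      simp
    rw [hfd]
    exact (heq (flipTime n w)).comp_add_const s s₀
  · intro s hs h0
    rw [hvel s hs] at h0
    exact h.velocity_ne_zero _ hs ((flipTime n).map_eq_zero_iff.1 h0)
  · intro s hs
    rw [hvel s hs, ← h.null _ hs]
    exact S.lorentzMetric_flipTime a _ _ _

end ElectrostaticSystem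

/-! ## Functions in charts of a manifold without boundary -/

section Charts

variable {E : Type*} [NormedAddCommGroup E] [NormedSpace ℝ E]
  {H : Type*} [TopologicalSpace H] {I : ModelWithCorners ℝ E H} [I.Boundaryless]
  {X : Type*} [TopologicalSpace X] [ChartedSpace H X] [IsManifold I ∞ X]

theorem contDiffAt_comp_extChartAt_symm {x : X} {z : E} (hz : z ∈ (extChartAt I x).target)
    {F : X → ℝ} (hF : ContMDiffAt I 𝓘(ℝ, ℝ) ∞ F ((extChartAt I x).symm z)) :
    ContDiffAt ℝ ∞ (fun y => F ((extChartAt I x).symm y)) z :=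
  contMDiffAt_iff_contDiffAt.1 (ContMDiffAt.comp (g := F) z hF
    ((contMDiffOn_extChartAt_symm x).contMDiffAt ((isOpen_extChartAt_target x).mem_nhds hz)))

theorem mdifferentiableAt_extChartAt_symm {x : X} {z : E} (hz : z ∈ (extChartAt I x).target) :
    MDifferentiableAt 𝓘(ℝ, E) I (extChartAt I x).symm z :=
  ((contMDiffOn_extChartAt_symm (n := ∞) x).contMDiffAt
    ((isOpen_extChartAt_target x).mem_nhds hz)).mdifferentiableAt (by simp)

theorem fderiv_comp_extChartAt_symm {x : X} {z : E} (hz : z ∈ (extChartAt I x).target)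
    {F : X → ℝ} (hF : ContMDiffAt I 𝓘(ℝ, ℝ) ∞ F ((extChartAt I x).symm z)) (v : E) :
    fderiv ℝ (fun y => F ((extChartAt I x).symm y)) z v =
      mfderiv I 𝓘(ℝ, ℝ) F ((extChartAt I x).symm z)
        (mfderiv 𝓘(ℝ, E) I (extChartAt I x).symm z v) := by
  rw [← mfderiv_eq_fderiv]
  have h := mfderiv_comp z (hF.mdifferentiableAt (by simp)) (mdifferentiableAt_extChartAt_symm hz)
  exact congrArg (fun L => L v) h

theorem mfderiv_extChartAt_symm_self (x : X) (v : E) :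
    mfderiv 𝓘(ℝ, E) I (extChartAt I x).symm (extChartAt I x x) v = v := by
  have : IsManifold I 1 X := IsManifold.of_le (n := ∞) (by exact_mod_cast le_top)
  have h := mfderivWithin_range_extChartAt_symm (I := I) (x := x)
  rw [ModelWithCorners.range_eq_univ, mfderivWithin_univ] at h
  rw [h]
  rfl

/-- At the centre of its own chart the inverse chart has identity differential, so the coordinate
derivative is the manifold derivative itself. -/
theorem hasStrictFDerivAt_comp_extChartAt_symm {x : X} {F : X → ℝ}
    (hF : ContMDiffAt I 𝓘(ℝ, ℝ) ∞ F x) :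
    HasStrictFDerivAt (fun y => F ((extChartAt I x).symm y))
      (mfderiv I 𝓘(ℝ, ℝ) F x : E →L[ℝ] ℝ) (extChartAt I x x) := by
  have hx : (extChartAt I x).symm (extChartAt I x x) = x := extChartAt_to_inv x
  have hF' : ContMDiffAt I 𝓘(ℝ, ℝ) ∞ F ((extChartAt I x).symm (extChartAt I x x)) := by rwa [hx]
  have h := (contDiffAt_comp_extChartAt_symm (mem_extChartAt_target x) hF').hasStrictFDerivAt
    (by simp)
  have he : fderiv ℝ (fun y => F ((extChartAt I x).symm y)) (extChartAt I x x) =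
      (mfderiv I 𝓘(ℝ, ℝ) F x : E →L[ℝ] ℝ) := by
    ext v
    rw [fderiv_comp_extChartAt_symm (mem_extChartAt_target x) hF', mfderiv_extChartAt_symm_self]
    rw [hx]
    rfl
  rwa [he] at h

/-- A tangent vector annihilated by a defining function is the velocity of a curve in the
hypersurface. -/
theorem IsDefiningFunctionAt.exists_curve [CompleteSpace E] {P : Set X} {p : X} {F : X → ℝ}
    (hF : IsDefiningFunctionAt I P p F) (hp : p ∈ P) (v : E)
    (hv : (mfderiv I 𝓘(ℝ, ℝ) F p : E →L[ℝ] ℝ) v = 0) :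
    ∃ k : ℝ → E, k 0 = extChartAt I p p ∧ HasStrictDerivAt k v 0 ∧
      (∀ᶠ s in 𝓝 0, (extChartAt I p).symm (k s) ∈ P) := by
  obtain ⟨U, hU, hpU, hsm, hd, hiff⟩ := hF
  have hstr := hasStrictFDerivAt_comp_extChartAt_symm (hsm.contMDiffAt (hU.mem_nhds hpU))
  set φ := extChartAt I p with hφ
  set ℓ : E →L[ℝ] ℝ := mfderiv I 𝓘(ℝ, ℝ) F p with hℓ
  have hsurj : ℓ.range = ⊤ := by
    rw [LinearMap.range_eq_top]
    exact LinearMap.surjective (f := (ℓ : E →ₗ[ℝ] ℝ))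
      fun h => hd p hpU (ContinuousLinearMap.coe_injective h)
  have hFp : F (φ.symm (φ p)) = 0 := by
    rw [extChartAt_to_inv p]
    exact (hiff p hpU).1 hp
  -- `g` parametrizes the level set over `ker ℓ`, with the inclusion as derivative at `0`; the
  -- desired curve is its restriction to the line spanned by `v`.
  set g := hstr.implicitFunction (fun y => F (φ.symm y)) ℓ hsurj (F (φ.symm (φ p))) with hg
  have hg0 : g 0 = φ p := hstr.implicitFunction_apply_image hsurj
  have hgd : HasStrictFDerivAt g ℓ.ker.subtypeL 0 := hstr.to_implicitFunction hsurj
  have hv' : v ∈ ℓ.ker := hv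
  have hlin : HasStrictDerivAt (fun s : ℝ => s • (⟨v, hv'⟩ : ℓ.ker)) (⟨v, hv'⟩ : ℓ.ker) 0 := by
    simpa using (hasStrictDerivAt_id (0 : ℝ)).smul_const (⟨v, hv'⟩ : ℓ.ker)
  have hkd : HasStrictDerivAt (fun s : ℝ => g (s • (⟨v, hv'⟩ : ℓ.ker))) v 0 := by
    have := HasStrictFDerivAt.comp_hasStrictDerivAt (0 : ℝ) (l := g) (l' := ℓ.ker.subtypeL)
      (f := fun s : ℝ => s • (⟨v, hv'⟩ : ℓ.ker)) (by simpa using hgd) hlin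
    exact this
  have hk0 : g ((0 : ℝ) • (⟨v, hv'⟩ : ℓ.ker)) = φ p := by rw [zero_smul, hg0]
  refine ⟨fun s => g (s • (⟨v, hv'⟩ : ℓ.ker)), hk0, hkd, ?_⟩
  have hcont : ContinuousAt (fun s : ℝ => g (s • (⟨v, hv'⟩ : ℓ.ker))) 0 :=
    hkd.hasDerivAt.continuousAt
  have hev : ∀ᶠ s : ℝ in 𝓝 0, φ.symm (g (s • (⟨v, hv'⟩ : ℓ.ker))) ∈ U := by
    have h1 : ContinuousAt φ.symm (φ p) := continuousAt_extChartAt_symm p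
    have h2 : ContinuousAt (fun s : ℝ => φ.symm (g (s • (⟨v, hv'⟩ : ℓ.ker)))) 0 :=
      ContinuousAt.comp (g := φ.symm) (by rw [hk0]; exact h1) hcont
    refine h2 (hU.mem_nhds ?_)
    beta_reduce
    rw [hk0, extChartAt_to_inv p]
    exact hpU
  have hev2 : ∀ᶠ s : ℝ in 𝓝 0, F (φ.symm (g (s • (⟨v, hv'⟩ : ℓ.ker)))) = 0 := by
    have h1 := hstr.map_implicitFunction_eq hsurj
    have h2 : Tendsto (fun s : ℝ => (F (φ.symm (φ p)), s • (⟨v, hv'⟩ : ℓ.ker))) (𝓝 0)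
        (𝓝 (F (φ.symm (φ p)), 0)) := by
      refine tendsto_const_nhds.prodMk_nhds ?_
      have := hlin.hasDerivAt.continuousAt.tendsto
      rwa [zero_smul] at this
    filter_upwards [h2.eventually h1] with s hs
    rw [hg]
    exact hs.trans hFp
  filter_upwards [hev, hev2] with s hs1 hs2
  exact (hiff _ hs1).2 hs2

end Charts

/-! ### Moving points along a transversal direction onto a zero set -/

section ImplicitRoot

variable {V : Type*} [NormedAddCommGroup V] [NormedSpace ℝ V]

/-- If `f` and `h` both have nonzero derivative in the direction `e`, then near a zero of `f` each
point can be moved along `e` to a zero of `f`, and the point does not move if `h` is unchanged. -/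
theorem eventually_exists_root_along {f h : V → ℝ} {f' h' : V →L[ℝ] ℝ} {z₀ e : V}
    (hf : HasStrictFDerivAt f f' z₀) (hfc : ∀ᶠ z in 𝓝 z₀, ContinuousAt f z) (hf0 : f z₀ = 0)
    (hfe : f' e ≠ 0) (hh : HasStrictFDerivAt h h' z₀) (hhe : h' e ≠ 0)
    {O : Set V} (hO : O ∈ 𝓝 z₀) :
    ∀ᶠ z in 𝓝 z₀, ∃ r : ℝ, z + r • e ∈ O ∧ f (z + r • e) = 0 ∧ (h (z + r • e) = h z → r = 0) := by
  -- With this bound on the error of the linear approximation of `h`, a displacement `r • e` changes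
  -- `h` whenever `r ≠ 0`, since the error is below `|r| |h' e|`.
  have hc : 0 < |h' e| / (2 * (‖e‖ + 1)) := by positivity
  have hstrict := hh.isLittleO.bound hc
  rw [nhds_prod_eq] at hstrict
  obtain ⟨W, hW, hWb⟩ := Filter.eventually_prod_self_iff'.1 hstrict
  obtain ⟨ρ, hρ, hball⟩ := Metric.mem_nhds_iff.1 (inter_mem (inter_mem hO hfc) hW)
  set a := f' e with ha
  have hline : HasDerivAt (fun r : ℝ => z₀ + r • e) e 0 := by
    simpa using ((hasDerivAt_id (0 : ℝ)).smul_const e).const_add z₀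
  have hg : HasDerivAt (fun r : ℝ => f (z₀ + r • e)) a 0 :=
    HasFDerivAt.comp_hasDerivAt (l := f) (l' := f') (0 : ℝ) (by simpa using hf.hasFDerivAt) hline
  have hsmall : ∀ᶠ r : ℝ in 𝓝 0, |f (z₀ + r • e) - r * a| ≤ |a| / 2 * |r| := by
    have := hg.isLittleO.bound (half_pos (abs_pos.2 hfe))
    filter_upwards [this] with r hr
    simpa [hf0] using hr
  obtain ⟨δ, hδ, hδb⟩ := Metric.eventually_nhds_iff.1 hsmall
  -- The first bound keeps the linear approximation of `f` valid; the second keeps all segments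
  -- starting in the ball of radius `ρ / 2` inside the ball of radius `ρ`.
  set r₀ := min (δ / 2) (ρ / (2 * (‖e‖ + 1))) with hr₀
  have hr₀pos : 0 < r₀ := by positivity
  have hr₀δ : r₀ < δ := (min_le_left _ _).trans_lt (by linarith)
  have hr₀ρ : r₀ * ‖e‖ < ρ / 2 := by
    have h1 : r₀ ≤ ρ / (2 * (‖e‖ + 1)) := min_le_right _ _
    rw [le_div_iff₀ (by positivity)] at h1
    nlinarith [norm_nonneg e]
  have hin : ∀ z ∈ Metric.ball z₀ (ρ / 2), ∀ r ∈ Icc (-r₀) r₀, z + r • e ∈ Metric.ball z₀ ρ := by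
    intro z hz r hr
    rw [Metric.mem_ball, dist_eq_norm] at hz ⊢
    have h1 : ‖r • e‖ ≤ r₀ * ‖e‖ := by
      rw [norm_smul]
      exact mul_le_mul_of_nonneg_right (abs_le.2 hr) (norm_nonneg e)
    calc ‖z + r • e - z₀‖ = ‖(z - z₀) + r • e‖ := by congr 1; abel
      _ ≤ ‖z - z₀‖ + ‖r • e‖ := norm_add_le _ _
      _ < ρ := by linarith
  have hsign : ∀ r ∈ Icc (-r₀) r₀, r ≠ 0 → 0 < r * (a * f (z₀ + r • e)) := by
    intro r hr hr0
    have h1 := hδb (y := r) (by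
      rw [Real.dist_eq, sub_zero]; exact (abs_le.2 hr).trans_lt hr₀δ)
    set A := f (z₀ + r • e)
    have h2 : |r * a| * |A - r * a| ≤ |r * a| * (|a| / 2 * |r|) :=
      mul_le_mul_of_nonneg_left h1 (abs_nonneg _)
    rw [← abs_mul] at h2
    have h3 : 0 < (r * a) ^ 2 := by positivity
    have h4 : |r * a| * (|a| / 2 * |r|) = (r * a) ^ 2 / 2 := by
      rw [← sq_abs (r * a), abs_mul]; ring
    rw [h4] at h2
    have h5 := (abs_le.1 h2).1
    nlinarith
  have hcont : ∀ r ∈ Icc (-r₀) r₀, ContinuousAt (fun z => a * f (z + r • e)) z₀ := fun r hr => by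
    have h1 : ContinuousAt f (z₀ + r • e) :=
      (hball (hin z₀ (Metric.mem_ball_self (half_pos hρ)) r hr)).1.2
    have h2 : ContinuousAt (fun z => f (z + r • e)) z₀ :=
      ContinuousAt.comp (g := f) h1 (by fun_prop)
    exact h2.const_mul a
  have hp : ∀ᶠ z in 𝓝 z₀, 0 < a * f (z + r₀ • e) := by
    refine (hcont r₀ ⟨by linarith, le_rfl⟩).eventually (lt_mem_nhds ?_)
    exact pos_of_mul_pos_right (hsign r₀ ⟨by linarith, le_rfl⟩ hr₀pos.ne') hr₀pos.le
  have hm : ∀ᶠ z in 𝓝 z₀, a * f (z + (-r₀) • e) < 0 := by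
    refine (hcont (-r₀) ⟨le_rfl, by linarith⟩).eventually (gt_mem_nhds ?_)
    nlinarith [hsign (-r₀) ⟨le_rfl, by linarith⟩ (by linarith)]
  filter_upwards [hp, hm, Metric.ball_mem_nhds z₀ (half_pos hρ)] with z hzp hzm hzb
  have hci : ContinuousOn (fun r : ℝ => a * f (z + r • e)) (Icc (-r₀) r₀) := by
    intro r hr
    have h1 : ContinuousAt f (z + r • e) := (hball (hin z hzb r hr)).1.2
    have h2 : ContinuousAt (fun r : ℝ => f (z + r • e)) r :=
      ContinuousAt.comp (g := f) h1 (by fun_prop)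
    exact (h2.const_mul a).continuousWithinAt
  -- `a * f` has opposite signs at the ends `±r₀` of the segment through `z₀`, hence also on nearby
  -- parallel segments.
  obtain ⟨r, hr, hr0⟩ := intermediate_value_Icc (by linarith) hci ⟨hzm.le, hzp.le⟩
  refine ⟨r, (hball (hin z hzb r hr)).1.1, ?_, fun heq => ?_⟩
  · exact (mul_eq_zero.1 hr0).resolve_left hfe
  · by_contra hrne
    have h1 := hWb (z + r • e) (hball (hin z hzb r hr)).2 z
      (hball (Metric.ball_subset_ball (by linarith) hzb)).2
    simp only [heq, sub_self, add_sub_cancel_left, map_smul, smul_eq_mul, zero_sub, norm_neg,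
      norm_mul, norm_smul, Real.norm_eq_abs] at h1
    have h2 : 0 < |r| := abs_pos.2 hrne
    have h3 : 0 < |h' e| := abs_pos.2 hhe
    have h4 : |h' e| / (2 * (‖e‖ + 1)) * (|r| * ‖e‖) < |r| * |h' e| := by
      rw [div_mul_eq_mul_div, div_lt_iff₀ (by positivity)]
      nlinarith [mul_pos h2 h3, mul_nonneg (mul_pos h2 h3).le (norm_nonneg e)]
    linarith

end ImplicitRoot

namespace ElectrostaticSystem

variable {n : ℕ} {M : Type*} [TopologicalSpace M]
  [ChartedSpace (EuclideanSpace ℝ (Fin n)) M] [IsManifold (𝓡 n) ∞ M]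
  {S : ElectrostaticSystem n M} {P : Set (ℝ × M)}

/-! ## Local structure of nondegenerate equipotential photon surfaces -/

/-- The differential of the lapse function. -/
noncomputable def lapseDeriv (S : ElectrostaticSystem n M) (x : M) :
    EuclideanSpace ℝ (Fin n) →L[ℝ] ℝ :=
  mfderiv (𝓡 n) 𝓘(ℝ, ℝ) S.lapse x

/-- The differential of a function on the spacetime. -/
noncomputable def spacetimeDeriv (F : ℝ × M → ℝ) (p : ℝ × M) :
    (ℝ × EuclideanSpace ℝ (Fin n)) →L[ℝ] ℝ :=
  mfderiv (spacetimeModel n) 𝓘(ℝ, ℝ) F p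

theorem mem_times {p : ℝ × M} (hp : p ∈ P) : p.1 ∈ times P := ⟨p.2, hp⟩

theorem lapseAlong_eq (hequi : S.IsEquipotential P) {p : ℝ × M} (hp : p ∈ P) :
    S.lapseAlong P p.1 = S.lapse p.2 := by
  have h : ∃ x, (p.1, x) ∈ P := ⟨p.2, hp⟩
  rw [lapseAlong, dif_pos h]
  exact (hequi p.1 _ _ h.choose_spec hp).1

theorem contMDiff_lapse_snd (S : ElectrostaticSystem n M) :
    ContMDiff (spacetimeModel n) 𝓘(ℝ, ℝ) ∞ (fun p : ℝ × M => S.lapse p.2) :=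
  S.lapse_smooth.comp contMDiff_snd

theorem spacetimeDeriv_lapse (p : ℝ × M) (v : ℝ × EuclideanSpace ℝ (Fin n)) :
    spacetimeDeriv (n := n) (fun p : ℝ × M => S.lapse p.2) p v = S.lapseDeriv p.2 v.2 := by
  have h := mfderiv_comp p (S.lapse_smooth.mdifferentiable (by simp) p.2)
    (mdifferentiableAt_snd (I := 𝓘(ℝ, ℝ)) (I' := 𝓡 n) (x := p))
  rw [mfderiv_snd] at h
  exact congrArg (fun L => L v) h

/-- Through each point of a hypersurface there are curves with given tangent velocity; here the
curve is recorded by its time and the value of the lapse function. -/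
theorem exists_curve_lapse (hequi : S.IsEquipotential P) {p : ℝ × M} (hp : p ∈ P) {F : ℝ × M → ℝ}
    (hF : IsDefiningFunctionAt (spacetimeModel n) P p F) {v : ℝ × EuclideanSpace ℝ (Fin n)}
    (hv : spacetimeDeriv F p v = 0) :
    ∃ τ ν : ℝ → ℝ, τ 0 = p.1 ∧ HasStrictDerivAt τ v.1 0 ∧
      HasStrictDerivAt ν (S.lapseDeriv p.2 v.2) 0 ∧
      ∀ᶠ s in 𝓝 0, τ s ∈ times P ∧ S.lapseAlong P (τ s) = ν s := by
  obtain ⟨k, hk0, hk, hkP⟩ := hF.exists_curve hp v hv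
  have hlapse := hasStrictFDerivAt_comp_extChartAt_symm (x := p) (S.contMDiff_lapse_snd p)
  refine ⟨fun s => (k s).1, fun s => S.lapse ((extChartAt (spacetimeModel n) p).symm (k s)).2,
    ?_, ?_, ?_, ?_⟩
  · simp only [hk0, extChartAt_spacetime]
  · exact (hasStrictFDerivAt_fst (p := k 0)).comp_hasStrictDerivAt 0 hk
  · rw [← hk0] at hlapse
    have h := hlapse.comp_hasStrictDerivAt 0 hk
    have h2 := spacetimeDeriv_lapse (S := S) p v
    rw [spacetimeDeriv] at h2
    rwa [h2] at h
  · filter_upwards [hkP] with s hs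
    have h := mem_times hs
    have h2 := lapseAlong_eq hequi hs
    rw [extChartAt_spacetime_symm] at h h2 ⊢
    exact ⟨h, h2⟩

theorem fst_ne_zero_of_timelike {p : ℝ × M} {v : ℝ × EuclideanSpace ℝ (Fin n)}
    (hv : S.lorentzMetric p v v < 0) : v.1 ≠ 0 := by
  intro h0
  change -(S.lapse p.2) ^ 2 * (v.1 * v.1) + S.metricAt p.2 v.2 v.2 < 0 at hv
  rw [h0, mul_zero, mul_zero, zero_add] at hv
  rcases eq_or_ne v.2 0 with h | h
  · simp [h] at hv
  · exact absurd hv (S.metricAt_pos p.2 h).le.not_gt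

/-- A timelike vector has nonzero time component. Normalizing it to `1` lets time parametrize a
curve in `P` in this direction. -/
theorem IsPhotonSurface.exists_definingFunction (hP : S.IsPhotonSurface P) {p : ℝ × M}
    (hp : p ∈ P) : ∃ F : ℝ × M → ℝ, IsDefiningFunctionAt (spacetimeModel n) P p F ∧
      ∃ v : ℝ × EuclideanSpace ℝ (Fin n), v.1 = 1 ∧ spacetimeDeriv F p v = 0 := by
  obtain ⟨(v : ℝ × EuclideanSpace ℝ (Fin n)), ⟨F, hF, hFv⟩, hv⟩ := hP.timelike p hp
  have hFv' : spacetimeDeriv F p v = 0 := hFv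
  refine ⟨F, hF, (v.1)⁻¹ • v, inv_mul_cancel₀ (fst_ne_zero_of_timelike hv), ?_⟩
  rw [map_smul, hFv', smul_zero]

/-- Along a curve in `P` with time derivative `1`, the time `τ` has a local inverse, and `u = ν ∘
τ⁻¹` with `ν` the lapse along the curve. In particular `𝒯` is open and `deriv` has its genuine
meaning at exceptional times. -/
theorem differentiableAt_lapseAlong (hP : S.IsPhotonSurface P) (hequi : S.IsEquipotential P)
    {t : ℝ} (ht : t ∈ times P) :
    DifferentiableAt ℝ (S.lapseAlong P) t ∧ times P ∈ 𝓝 t := by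
  obtain ⟨x, hx⟩ := ht
  obtain ⟨F, hF, v, hv1, hFv⟩ := hP.exists_definingFunction hx
  obtain ⟨τ, ν, hτ0, hτ, hν, hev⟩ := exists_curve_lapse hequi hx hF hFv
  rw [hv1] at hτ
  have hinv := hτ.to_localInverse one_ne_zero
  have hr := hτ.eventually_right_inverse one_ne_zero
  have hl0 : hτ.localInverse τ 1 0 one_ne_zero (τ 0) = 0 :=
    (hτ.eventually_left_inverse one_ne_zero).self_of_nhds
  simp only at hτ0
  set σ := hτ.localInverse τ 1 0 one_ne_zero with hσ
  rw [hτ0] at hinv hr hl0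
  have hσc : Tendsto σ (𝓝 t) (𝓝 0) := by
    have := hinv.hasDerivAt.continuousAt.tendsto
    rwa [hl0] at this
  have hev2 := hσc.eventually hev
  constructor
  · have h1 : HasDerivAt (fun t => ν (σ t)) _ t :=
      HasDerivAt.comp (h₂ := ν) t (by rw [hl0]; exact hν.hasDerivAt) hinv.hasDerivAt
    have h2 : S.lapseAlong P =ᶠ[𝓝 t] fun t => ν (σ t) := by
      filter_upwards [hr, hev2] with t' h1 h2
      rw [← h2.2, h1]
    exact (h1.congr_of_eventuallyEq h2).differentiableAt
  · filter_upwards [hr, hev2] with t' h1 h2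
    rw [← h1]
    exact h2.1

/-- Differentiate `N = u(t)` along a curve in `P` with velocity `v`. -/
theorem lapseDeriv_of_tangent (hP : S.IsPhotonSurface P) (hequi : S.IsEquipotential P)
    {p : ℝ × M} (hp : p ∈ P) {F : ℝ × M → ℝ}
    (hF : IsDefiningFunctionAt (spacetimeModel n) P p F) {v : ℝ × EuclideanSpace ℝ (Fin n)}
    (hv : spacetimeDeriv F p v = 0) :
    S.lapseDeriv p.2 v.2 = deriv (S.lapseAlong P) p.1 * v.1 := by
  obtain ⟨τ, ν, hτ0, hτ, hν, hev⟩ := exists_curve_lapse hequi hp hF hv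
  have hu := (differentiableAt_lapseAlong hP hequi (mem_times hp)).1.hasDerivAt
  rw [← hτ0] at hu ⊢
  have h1 := hu.comp 0 hτ.hasDerivAt
  refine hν.hasDerivAt.unique (h1.congr_of_eventuallyEq ?_)
  filter_upwards [hev] with s hs using hs.2.symm

/-- The tangent vectors of `P`, in terms of the lapse function. -/
theorem mem_tangentSet_iff (hP : S.IsPhotonSurface P) (hequi : S.IsEquipotential P)
    (hnd : S.IsNondegenerate P) {p : ℝ × M} (hp : p ∈ P) (v : ℝ × EuclideanSpace ℝ (Fin n)) :
    v ∈ tangentSet (spacetimeModel n) P p ↔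
      S.lapseDeriv p.2 v.2 = deriv (S.lapseAlong P) p.1 * v.1 := by
  constructor
  · rintro ⟨F, hF, hFv⟩
    exact lapseDeriv_of_tangent hP hequi hp hF hFv
  · intro hv
    obtain ⟨F, hF⟩ := hP.hypersurface p hp
    refine ⟨F, hF, ?_⟩
    have hFne : spacetimeDeriv (n := n) F p ≠ 0 := by
      obtain ⟨U, hU, hpU, -, hd, -⟩ := hF
      exact hd p hpU
    obtain ⟨e, he⟩ : ∃ e, spacetimeDeriv F p e = 1 := by
      obtain ⟨e, he⟩ := ContinuousLinearMap.exists_ne_zero hFne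
      exact ⟨(spacetimeDeriv F p e)⁻¹ • e, by rw [map_smul, smul_eq_mul, inv_mul_cancel₀ he]⟩
    -- The form `dN - u̇ dt` vanishes on `ker dF`, hence is a multiple of `dF`; the factor is
    -- nonzero because `dN ≠ 0`, so the two kernels agree.
    have hker : ∀ w : ℝ × EuclideanSpace ℝ (Fin n),
        S.lapseDeriv p.2 w.2 - deriv (S.lapseAlong P) p.1 * w.1 =
        spacetimeDeriv F p w *
          (S.lapseDeriv p.2 e.2 - deriv (S.lapseAlong P) p.1 * e.1) := by
      intro w
      have h := lapseDeriv_of_tangent hP hequi hp hF (v := w - spacetimeDeriv F p w • e)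
        (by rw [map_sub, map_smul, he]; simp)
      simp only [Prod.snd_sub, Prod.smul_snd, map_sub, map_smul, smul_eq_mul, Prod.fst_sub,
        Prod.smul_fst] at h
      linarith
    have hne : S.lapseDeriv p.2 e.2 - deriv (S.lapseAlong P) p.1 * e.1 ≠ 0 := by
      intro h0
      refine hnd p hp (?_ : S.lapseDeriv p.2 = 0)
      ext w
      have := hker (0, w)
      rw [h0] at this
      simpa using this
    have := hker v
    rw [hv, sub_self] at this
    exact (mul_eq_zero.1 this.symm).resolve_right hne

/-- Near its points, `P` is the set `N = u(t)`. -/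
theorem eventually_mem_iff (hP : S.IsPhotonSurface P) (hequi : S.IsEquipotential P)
    (hnd : S.IsNondegenerate P) {p : ℝ × M} (hp : p ∈ P) :
    ∀ᶠ q in 𝓝 p, q ∈ P ↔ S.lapse q.2 = S.lapseAlong P q.1 := by
  obtain ⟨F, hF⟩ := hP.hypersurface p hp
  have hF' := hF
  obtain ⟨U, hU, hpU, hsm, hd, hiff⟩ := hF
  obtain ⟨w, hw⟩ := ContinuousLinearMap.exists_ne_zero (show S.lapseDeriv p.2 ≠ 0 from hnd p hp)
  set φ := extChartAt (spacetimeModel n) p with hφ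
  -- A purely spatial tangent vector of `P` is annihilated by `dN`, and `w` is not.
  have hFe : spacetimeDeriv F p (0, w) ≠ 0 := by
    intro h0
    have := lapseDeriv_of_tangent hP hequi hp hF' h0
    simp only [mul_zero] at this
    exact hw this
  have hNe : spacetimeDeriv (n := n) (fun p : ℝ × M => S.lapse p.2) p (0, w) ≠ 0 := by
    rw [spacetimeDeriv_lapse]
    exact hw
  have hO : φ.target ∩ φ.symm ⁻¹' U ∈ 𝓝 (φ p) := by
    refine inter_mem ((isOpen_extChartAt_target p).mem_nhds (mem_extChartAt_target p)) ?_
    refine (continuousAt_extChartAt_symm p) (hU.mem_nhds ?_)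
    rw [extChartAt_to_inv p]
    exact hpU
  have hcont : ∀ᶠ z in 𝓝 (φ p), ContinuousAt (fun z => F (φ.symm z)) z := by
    filter_upwards [hO] with z hz
    exact (contDiffAt_comp_extChartAt_symm hz.1
      (hsm.contMDiffAt (hU.mem_nhds hz.2))).continuousAt
  have hroot := eventually_exists_root_along
    (hasStrictFDerivAt_comp_extChartAt_symm (hsm.contMDiffAt (hU.mem_nhds hpU))) hcont
    (by rw [extChartAt_to_inv p]; exact (hiff p hpU).1 hp) hFe
    (hasStrictFDerivAt_comp_extChartAt_symm (x := p) (S.contMDiff_lapse_snd p)) hNe hO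
  have hsrc : φ.source ∈ 𝓝 p := extChartAt_source_mem_nhds p
  filter_upwards [hsrc, (continuousAt_extChartAt p).eventually hroot] with q hq hqroot
  refine ⟨fun h => (lapseAlong_eq hequi h).symm, fun h => ?_⟩
  -- Moving `q` along `(0, w)` reaches `P` without changing the time, so the lapse there is
  -- `u(q.1)`, already its value at `q`. Hence `q` has not moved.
  obtain ⟨r, hrO, hr0, hrN⟩ := hqroot
  have hmem : φ.symm (φ q + r • ((0, w) : ℝ × EuclideanSpace ℝ (Fin n))) ∈ P :=
    (hiff _ hrO.2).2 hr0
  have hu := lapseAlong_eq hequi hmem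
  have htime : (φ.symm (φ q + r • ((0, w) : ℝ × EuclideanSpace ℝ (Fin n)))).1 = q.1 := by
    rw [hφ, extChartAt_spacetime_symm, extChartAt_spacetime]
    simp
  rw [htime] at hu
  have hq' : φ.symm (φ q) = q := φ.left_inv hq
  have hr : r = 0 := hrN (by rw [hq', h, hu])
  rw [hr, zero_smul, add_zero, hq'] at hmem
  exact hmem

end ElectrostaticSystem

namespace ElectrostaticSystem

variable {n : ℕ} {M : Type*} [TopologicalSpace M]
  [ChartedSpace (EuclideanSpace ℝ (Fin n)) M] [IsManifold (𝓡 n) ∞ M]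
  {S : ElectrostaticSystem n M} {P : Set (ℝ × M)}

/-! ## Null vectors tangent to a photon surface -/

theorem lorentzMetric_eq (p : ℝ × M) (v w : ℝ × EuclideanSpace ℝ (Fin n)) :
    S.lorentzMetric p v w = -(S.lapse p.2) ^ 2 * (v.1 * w.1) + S.metricAt p.2 v.2 w.2 := rfl

theorem fst_ne_zero_of_null {p : ℝ × M} {v : ℝ × EuclideanSpace ℝ (Fin n)} (hv : v ≠ 0)
    (hnull : S.lorentzMetric p v v = 0) : v.1 ≠ 0 := by
  intro h0
  rw [lorentzMetric_eq, h0, mul_zero, mul_zero, zero_add] at hnull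
  have h2 : v.2 ≠ 0 := fun h => hv (Prod.ext h0 h)
  exact (S.metricAt_pos p.2 h2).ne' hnull

/-- The plane spanned by a timelike and a nonzero purely spatial vector contains two null
directions. -/
theorem exists_null_pair {p : ℝ × M} {v : ℝ × EuclideanSpace ℝ (Fin n)}
    (hv : S.lorentzMetric p v v < 0) {x : EuclideanSpace ℝ (Fin n)} (hx : x ≠ 0) :
    ∃ a b : ℝ, a ≠ b ∧ S.lorentzMetric p ((0, x) + a • v) ((0, x) + a • v) = 0 ∧
      S.lorentzMetric p ((0, x) + b • v) ((0, x) + b • v) = 0 := by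
  set A := S.lorentzMetric p v v with hA
  set B := S.metricAt p.2 x v.2 with hB
  set C := S.metricAt p.2 x x with hC
  have hCpos : 0 < C := S.metricAt_pos p.2 hx
  have hexp : ∀ r : ℝ, S.lorentzMetric p ((0, x) + r • v) ((0, x) + r • v) =
      A * r ^ 2 + 2 * B * r + C := by
    intro r
    have h : S.lorentzMetric p ((0, x) + r • v) ((0, x) + r • v) =
      -(S.lapse p.2) ^ 2 * ((0 + r * v.1) * (0 + r * v.1)) +
        S.metricAt p.2 (x + r • v.2) (x + r • v.2) := rfl
    rw [h, hA, lorentzMetric_eq]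
    simp only [map_add, map_smul, add_apply, smul_apply, smul_eq_mul]
    rw [S.metricAt_symm p.2 v.2 x]
    ring
  -- `A < 0 < C`, so the quadratic has two distinct real roots.
  have hdisc : 0 < B ^ 2 - A * C := by nlinarith [sq_nonneg B]
  set R := Real.sqrt (B ^ 2 - A * C) with hR
  have hRpos : 0 < R := Real.sqrt_pos.2 hdisc
  have hRsq : R ^ 2 = B ^ 2 - A * C := Real.sq_sqrt hdisc.le
  have hA0 : A ≠ 0 := hv.ne
  refine ⟨(-B + R) / A, (-B - R) / A, ?_, ?_, ?_⟩
  · intro h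
    rw [div_left_inj' hA0] at h
    linarith
  · rw [hexp]
    field_simp
    linear_combination hRsq
  · rw [hexp]
    field_simp
    linear_combination hRsq

/-- The kernel of one linear form on a space of dimension at least two is nontrivial. -/
theorem exists_spatial_tangent (hn : 2 ≤ n) (S : ElectrostaticSystem n M) (x : M) :
    ∃ w : EuclideanSpace ℝ (Fin n), w ≠ 0 ∧ S.lapseDeriv x w = 0 := by
  have h := LinearMap.ker_ne_bot_of_finrank_lt
    (f := (S.lapseDeriv x : EuclideanSpace ℝ (Fin n) →ₗ[ℝ] ℝ)) (by
      rw [finrank_euclideanSpace_fin, Module.finrank_self]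
      omega)
  obtain ⟨w, hw, hw0⟩ := Submodule.exists_mem_ne_zero_of_ne_bot h
  exact ⟨w, hw0, hw⟩

theorem IsPhotonSurface.exists_timelike (hP : S.IsPhotonSurface P) (hequi : S.IsEquipotential P)
    (hnd : S.IsNondegenerate P) {p : ℝ × M} (hp : p ∈ P) :
    ∃ v : ℝ × EuclideanSpace ℝ (Fin n), S.lorentzMetric p v v < 0 ∧
      S.lapseDeriv p.2 v.2 = deriv (S.lapseAlong P) p.1 * v.1 := by
  obtain ⟨(v : ℝ × EuclideanSpace ℝ (Fin n)), hvT, hv⟩ := hP.timelike p hp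
  exact ⟨v, hv, (mem_tangentSet_iff hP hequi hnd hp v).1 hvT⟩

/-- Two different null vectors tangent to `P`, on the line through a spatial tangent vector in the
direction of a timelike one. -/
theorem exists_tangent_null_pair (hP : S.IsPhotonSurface P) (hequi : S.IsEquipotential P)
    (hnd : S.IsNondegenerate P) {p : ℝ × M} (hp : p ∈ P) {v : ℝ × EuclideanSpace ℝ (Fin n)}
    (hv : S.lorentzMetric p v v < 0)
    (hvT : S.lapseDeriv p.2 v.2 = deriv (S.lapseAlong P) p.1 * v.1)
    {x : EuclideanSpace ℝ (Fin n)} (hx : x ≠ 0) (hxT : S.lapseDeriv p.2 x = 0) :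
    ∃ a b : ℝ, a ≠ b ∧ ∀ c ∈ ({a, b} : Set ℝ),
      ((0, x) + c • v : ℝ × EuclideanSpace ℝ (Fin n)) ≠ 0 ∧
      S.lorentzMetric p ((0, x) + c • v) ((0, x) + c • v) = 0 ∧
      ((0, x) + c • v : ℝ × EuclideanSpace ℝ (Fin n)) ∈ tangentSet (spacetimeModel n) P p := by
  obtain ⟨a, b, hab, ha, hb⟩ := exists_null_pair hv hx
  have hT : ∀ c : ℝ, ((0, x) + c • v : ℝ × EuclideanSpace ℝ (Fin n)) ∈
      tangentSet (spacetimeModel n) P p := fun c => by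
    rw [mem_tangentSet_iff hP hequi hnd hp]
    simp only [Prod.fst_add, Prod.snd_add, Prod.smul_fst, Prod.smul_snd, map_add, map_smul, hxT,
      hvT, smul_eq_mul]
    ring
  have h0 : ∀ c : ℝ, ((0, x) + c • v : ℝ × EuclideanSpace ℝ (Fin n)) ≠ 0 := fun c hc => by
    have h1 : (0 : ℝ) + c * v.1 = 0 := congrArg Prod.fst hc
    have h2 : x + c • v.2 = 0 := congrArg Prod.snd hc
    rw [zero_add] at h1
    have h3 := (mul_eq_zero.1 h1).resolve_right (fst_ne_zero_of_timelike hv)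
    rw [h3, zero_smul, add_zero] at h2
    exact hx h2
  refine ⟨a, b, hab, ?_⟩
  rintro c (rfl | rfl)
  · exact ⟨h0 _, ha, hT _⟩
  · exact ⟨h0 _, hb, hT _⟩

theorem exists_null_tangent (hn : 2 ≤ n) (hP : S.IsPhotonSurface P) (hequi : S.IsEquipotential P)
    (hnd : S.IsNondegenerate P) {p : ℝ × M} (hp : p ∈ P) :
    ∃ w : ℝ × EuclideanSpace ℝ (Fin n), w ≠ 0 ∧ S.lorentzMetric p w w = 0 ∧
      w ∈ tangentSet (spacetimeModel n) P p := by
  obtain ⟨v, hv, hvT⟩ := hP.exists_timelike hequi hnd hp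
  obtain ⟨x, hx, hxT⟩ := exists_spatial_tangent hn S p.2
  obtain ⟨a, b, -, h⟩ := exists_tangent_null_pair hP hequi hnd hp hv hvT hx hxT
  exact ⟨_, h a (by simp)⟩

/-- The null vectors tangent to `P` span the tangent space of `P`. -/
theorem eq_zero_of_null_eq_zero (hn : 2 ≤ n) (hP : S.IsPhotonSurface P)
    (hequi : S.IsEquipotential P) (hnd : S.IsNondegenerate P) {p : ℝ × M} (hp : p ∈ P)
    {ℓ : (ℝ × EuclideanSpace ℝ (Fin n)) →L[ℝ] ℝ}
    (hℓ : ∀ w : ℝ × EuclideanSpace ℝ (Fin n), w ≠ 0 → S.lorentzMetric p w w = 0 →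
      w ∈ tangentSet (spacetimeModel n) P p → ℓ w = 0)
    {y : ℝ × EuclideanSpace ℝ (Fin n)} (hy : y ∈ tangentSet (spacetimeModel n) P p) :
    ℓ y = 0 := by
  obtain ⟨v, hv, hvT⟩ := hP.exists_timelike hequi hnd hp
  have key : ∀ x : EuclideanSpace ℝ (Fin n), x ≠ 0 → S.lapseDeriv p.2 x = 0 →
      ℓ v = 0 ∧ ℓ (0, x) = 0 := by
    intro x hx hxT
    obtain ⟨a, b, hab, h⟩ := exists_tangent_null_pair hP hequi hnd hp hv hvT hx hxT
    obtain ⟨a1, a2, a3⟩ := h a (by simp)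
    obtain ⟨b1, b2, b3⟩ := h b (by simp)
    have ha := hℓ _ a1 a2 a3
    have hb := hℓ _ b1 b2 b3
    rw [map_add, map_smul, smul_eq_mul] at ha hb
    -- The two null vectors differ by a nonzero multiple of `v`, so `ℓ` vanishes on `v` and then on
    -- `(0, x)`.
    have h1 : (a - b) * ℓ v = 0 := by linarith
    have h2 : ℓ v = 0 := (mul_eq_zero.1 h1).resolve_left (sub_ne_zero.2 hab)
    rw [h2, mul_zero, add_zero] at ha
    exact ⟨h2, ha⟩
  have hℓv : ℓ v = 0 := by
    obtain ⟨x, hx, hxT⟩ := exists_spatial_tangent hn S p.2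
    exact (key x hx hxT).1
  have hv1 := fst_ne_zero_of_timelike hv
  rw [mem_tangentSet_iff hP hequi hnd hp] at hy
  set x := y.2 - (y.1 / v.1) • v.2 with hx
  have hxT : S.lapseDeriv p.2 x = 0 := by
    rw [hx, map_sub, map_smul, hy, hvT, smul_eq_mul]
    field_simp
    ring
  have hdecomp : y = (0, x) + (y.1 / v.1) • v := by
    ext1
    · simp [hv1]
    · simp [hx]
  have hℓx : ℓ (0, x) = 0 := by
    rcases eq_or_ne x 0 with h | h
    · rw [h]
      exact map_zero ℓ
    · exact (key x h hxT).2
  rw [hdecomp, map_add, map_smul, hℓx, hℓv]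
  simp

/-- Null geodesics in `P` with prescribed null tangent vector. -/
theorem IsPhotonSurface.exists_nullGeodesic (hP : S.IsPhotonSurface P) {p : ℝ × M} (hp : p ∈ P)
    {w : ℝ × EuclideanSpace ℝ (Fin n)} (hw : w ≠ 0) (hnull : S.lorentzMetric p w w = 0)
    (hT : w ∈ tangentSet (spacetimeModel n) P p) :
    ∃ (γ : ℝ → ℝ × M) (J : Set ℝ), IsNullGeodesicOn (spacetimeModel n) S.lorentzMetric γ J ∧
      0 ∈ J ∧ γ 0 = p ∧ velocity (spacetimeModel n) γ 0 = w ∧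
      ∀ s ∈ J, γ s ∈ P ∧
        velocity (spacetimeModel n) γ s ∈ tangentSet (spacetimeModel n) P (γ s) := by
  obtain ⟨γ, J, hγ, h0, rfl, hv⟩ := ElectrostaticSystem.exists_nullGeodesic S p w hw hnull
  exact ⟨γ, J, hγ, h0, rfl, hv, hP.null_totally_geodesic γ J hγ h0 hp (hv ▸ hT)⟩

/-! ## Sets that are saturated under null geodesics -/

/-- An auxiliary inner product on the product of the time axis and a Euclidean space. -/
noncomputable def auxInner (x : ℝ × EuclideanSpace ℝ (Fin n)) :
    (ℝ × EuclideanSpace ℝ (Fin n)) →L[ℝ] ℝ :=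
  x.1 • ContinuousLinearMap.fst ℝ ℝ (EuclideanSpace ℝ (Fin n)) +
    (innerSL ℝ x.2).comp (ContinuousLinearMap.snd ℝ ℝ (EuclideanSpace ℝ (Fin n)))

theorem auxInner_apply (x y : ℝ × EuclideanSpace ℝ (Fin n)) :
    auxInner x y = x.1 * y.1 + inner ℝ x.2 y.2 := rfl

theorem auxInner_self (x : ℝ × EuclideanSpace ℝ (Fin n)) :
    auxInner x x = x.1 ^ 2 + ‖x.2‖ ^ 2 := by
  rw [auxInner_apply, real_inner_self_eq_norm_sq, sq x.1]

theorem norm_sq_le_auxInner (x : ℝ × EuclideanSpace ℝ (Fin n)) : ‖x‖ ^ 2 ≤ auxInner x x := by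
  rw [auxInner_self, Prod.norm_def]
  rcases max_choice ‖x.1‖ ‖x.2‖ with h | h <;> rw [h]
  · rw [Real.norm_eq_abs, sq_abs]
    nlinarith [sq_nonneg ‖x.2‖]
  · nlinarith [sq_nonneg x.1]

theorem abs_auxInner_le (x y : ℝ × EuclideanSpace ℝ (Fin n)) :
    |auxInner x y| ≤ 2 * ‖x‖ * ‖y‖ := by
  rw [auxInner_apply]
  have h1 : |x.1 * y.1| ≤ ‖x‖ * ‖y‖ := by
    rw [abs_mul]
    exact mul_le_mul (norm_fst_le x) (norm_fst_le y) (abs_nonneg _) (norm_nonneg _)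
  have h2 : |inner ℝ x.2 y.2| ≤ ‖x‖ * ‖y‖ := (abs_real_inner_le_norm _ _).trans
    (mul_le_mul (norm_snd_le x) (norm_snd_le y) (norm_nonneg _) (norm_nonneg _))
  linarith [abs_add_le (x.1 * y.1) (inner ℝ x.2 y.2)]

theorem hasDerivAt_auxInner_self {ζ : ℝ → ℝ × EuclideanSpace ℝ (Fin n)}
    {ζ' : ℝ × EuclideanSpace ℝ (Fin n)} {s : ℝ} (h : HasDerivAt ζ ζ' s) :
    HasDerivAt (fun r => auxInner (ζ r) (ζ r)) (2 * auxInner (ζ s) ζ') s := by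
  have h1 : HasDerivAt (fun r => (ζ r).1) ζ'.1 s := (hasFDerivAt_fst (p := ζ s)).comp_hasDerivAt s h
  have h2 : HasDerivAt (fun r => (ζ r).2) ζ'.2 s := (hasFDerivAt_snd (p := ζ s)).comp_hasDerivAt s h
  refine ((h1.mul h1).add (h2.inner ℝ h2)).congr_deriv ?_
  rw [auxInner_apply, real_inner_comm ζ'.2]
  ring

/-- Chords of a level hypersurface are not orthogonal to it near a regular point. -/
theorem exists_tangent_not_orthogonal {f : ℝ × EuclideanSpace ℝ (Fin n) → ℝ}
    {z₀ : ℝ × EuclideanSpace ℝ (Fin n)} (hf : ContDiffAt ℝ ∞ f z₀) (hf' : fderiv ℝ f z₀ ≠ 0) :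
    ∃ W ∈ 𝓝 z₀, ∀ a ∈ W, ∀ c ∈ W, f a = 0 → f c = 0 → a ≠ c →
      ∃ y, fderiv ℝ f c y = 0 ∧ auxInner (c - a) y ≠ 0 := by
  obtain ⟨e, he⟩ : ∃ e, fderiv ℝ f z₀ e = 1 := by
    obtain ⟨e, he⟩ := ContinuousLinearMap.exists_ne_zero hf'
    exact ⟨(fderiv ℝ f z₀ e)⁻¹ • e, by rw [map_smul, smul_eq_mul, inv_mul_cancel₀ he]⟩
  -- Chosen so that `8 η ‖e‖ ≤ 1 / 2`, the margin used in the final estimate.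
  set η : ℝ := 1 / (16 * (‖e‖ + 1)) with hη
  have hηpos : 0 < η := by positivity
  have hηe : η * ‖e‖ ≤ 1 / 16 := by
    rw [hη, div_mul_eq_mul_div, div_le_div_iff₀ (by positivity) (by norm_num)]
    linarith
  have hstrict := (hf.hasStrictFDerivAt (by simp)).isLittleO.bound hηpos
  rw [nhds_prod_eq] at hstrict
  obtain ⟨W, hW, hWb⟩ := Filter.eventually_prod_self_iff'.1 hstrict
  have hcont : ContinuousAt (fderiv ℝ f) z₀ := (hf.fderiv_right (m := 0) (by simp)).continuousAt
  have hnear : ∀ᶠ c in 𝓝 z₀, ‖fderiv ℝ f c - fderiv ℝ f z₀‖ ≤ η := by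
    filter_upwards [Metric.continuousAt_iff'.1 hcont η hηpos] with c hc
    rw [← dist_eq_norm]
    exact hc.le
  refine ⟨W ∩ _, inter_mem hW hnear, ?_⟩
  rintro a ⟨haW, -⟩ c ⟨hcW, hc⟩ ha0 hc0 hac
  simp only [mem_ofPred_eq] at hc
  set D := fderiv ℝ f c with hD
  have h1 := hWb c hcW a haW
  simp only [ha0, hc0, sub_self, zero_sub, norm_neg] at h1
  have h2 : ∀ v, |D v - fderiv ℝ f z₀ v| ≤ η * ‖v‖ := fun v => by
    have := (D - fderiv ℝ f z₀).le_of_opNorm_le hc v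
    rwa [sub_apply, Real.norm_eq_abs] at this
  have h3 : |D (c - a)| ≤ 2 * (η * ‖c - a‖) := by
    have h := h2 (c - a)
    rw [Real.norm_eq_abs] at h1
    rw [abs_le] at h h1 ⊢
    constructor <;> linarith [h.1, h.2, h1.1, h1.2]
  have h4 : 1 / 2 ≤ D e := by
    have h := (abs_le.1 (h2 e)).1
    rw [he] at h
    linarith
  have hDe : D e ≠ 0 := by linarith
  -- The projection of the chord to `ker D` along `e`. Since `D (c - a)` is of size at most `2 η ‖c
  -- - a‖` and `D e ≥ 1 / 2`, the correction is too small to make it orthogonal to the chord.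
  refine ⟨(c - a) - (D (c - a) / D e) • e, ?_, fun h0 => ?_⟩
  · rw [map_sub, map_smul, smul_eq_mul, div_mul_cancel₀ _ hDe, sub_self]
  · rw [map_sub, map_smul, smul_eq_mul, sub_eq_zero] at h0
    have hpos : 0 < ‖c - a‖ := norm_pos_iff.2 (sub_ne_zero.2 hac.symm)
    have h5 := norm_sq_le_auxInner (c - a)
    have h6 : |D (c - a) / D e| ≤ 4 * (η * ‖c - a‖) := by
      rw [abs_div, div_le_iff₀ (abs_pos.2 hDe), abs_of_pos (show 0 < D e by linarith)]
      have : 0 < η * ‖c - a‖ := by positivity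
      nlinarith
    have h7 := abs_auxInner_le (c - a) e
    have h8 : |D (c - a) / D e * auxInner (c - a) e| ≤
        4 * (η * ‖c - a‖) * (2 * ‖c - a‖ * ‖e‖) := by
      rw [abs_mul]
      exact mul_le_mul h6 h7 (abs_nonneg _) (by positivity)
    have h9 : 4 * (η * ‖c - a‖) * (2 * ‖c - a‖ * ‖e‖) = 8 * (η * ‖e‖) * ‖c - a‖ ^ 2 := by ring
    have h10 : 0 < ‖c - a‖ ^ 2 := by positivity
    have h11 := le_abs_self (D (c - a) / D e * auxInner (c - a) e)
    nlinarith

theorem hasDerivAt_extChartAt_comp {x : ℝ × M} {γ : ℝ → ℝ × M} {s : ℝ}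
    (hγ : MDifferentiableAt 𝓘(ℝ, ℝ) (spacetimeModel n) γ s)
    (hs : γ s ∈ (extChartAt (spacetimeModel n) x).source) :
    HasDerivAt (fun r => extChartAt (spacetimeModel n) x (γ r))
      (mfderiv (spacetimeModel n) 𝓘(ℝ, ℝ × EuclideanSpace ℝ (Fin n))
        (extChartAt (spacetimeModel n) x) (γ s) (velocity (spacetimeModel n) γ s)) s := by
  have : IsManifold (𝓡 n) 1 M := isManifold_one
  rw [extChartAt_source] at hs
  have h := (mdifferentiableAt_extChartAt hs).hasMFDerivAt.comp s hγ.hasMFDerivAt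
  have key : ∀ (L₁ : (ℝ × EuclideanSpace ℝ (Fin n)) →L[ℝ] (ℝ × EuclideanSpace ℝ (Fin n)))
      (L₂ : ℝ →L[ℝ] (ℝ × EuclideanSpace ℝ (Fin n))),
      HasFDerivAt (fun r => extChartAt (spacetimeModel n) x (γ r)) (L₁.comp L₂) s →
      HasDerivAt (fun r => extChartAt (spacetimeModel n) x (γ r)) (L₁ (L₂ 1)) s :=
    fun _ _ h => h.hasDerivAt
  exact key _ _ (hasMFDerivAt_iff_hasFDerivAt.1 h)

/-- A subset of `P` that is open in `P` and saturated under the null geodesics in `P` is closed in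
`P`. -/
theorem eventually_notMem_of_saturated (hn : 2 ≤ n) (hP : S.IsPhotonSurface P)
    (hequi : S.IsEquipotential P) (hnd : S.IsNondegenerate P) {u : Set (ℝ × M)} (hu : IsOpen u)
    (hsat : ∀ (γ : ℝ → ℝ × M) (J : Set ℝ),
      IsNullGeodesicOn (spacetimeModel n) S.lorentzMetric γ J →
      (∀ s ∈ J, γ s ∈ P ∧
        velocity (spacetimeModel n) γ s ∈ tangentSet (spacetimeModel n) P (γ s)) →
      ∀ s ∈ J, ∀ s' ∈ J, γ s ∈ u → γ s' ∈ u)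
    {p : ℝ × M} (hp : p ∈ P) (hpu : p ∉ u) : ∀ᶠ q in 𝓝 p, q ∈ P → q ∉ u := by
  obtain ⟨F, hF⟩ := hP.hypersurface p hp
  obtain ⟨U, hU, hpU, hsm, hd, hiff⟩ := hF
  set φ := extChartAt (spacetimeModel n) p with hφ
  set f : ℝ × EuclideanSpace ℝ (Fin n) → ℝ := fun z => F (φ.symm z) with hf
  have hinv : φ.symm (φ p) = p := extChartAt_to_inv p
  have hO : φ.target ∩ φ.symm ⁻¹' U ∈ 𝓝 (φ p) := by
    refine inter_mem ((isOpen_extChartAt_target p).mem_nhds (mem_extChartAt_target p)) ?_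
    refine (continuousAt_extChartAt_symm p) (hU.mem_nhds ?_)
    rw [hinv]
    exact hpU
  have hfsm : ∀ z ∈ φ.target ∩ φ.symm ⁻¹' U, ContDiffAt ℝ ∞ f z := fun z hz =>
    contDiffAt_comp_extChartAt_symm hz.1 (hsm.contMDiffAt (hU.mem_nhds hz.2))
  have hfd : fderiv ℝ f (φ p) ≠ 0 := by
    have h : HasStrictFDerivAt f (spacetimeDeriv (n := n) F p) (φ p) :=
      hasStrictFDerivAt_comp_extChartAt_symm (hsm.contMDiffAt (hU.mem_nhds hpU))
    rw [h.hasFDerivAt.fderiv]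
    exact hd p hpU
  obtain ⟨W, hW, hWy⟩ := exists_tangent_not_orthogonal
    (hfsm (φ p) (mem_of_mem_nhds hO)) hfd
  obtain ⟨ρ, hρ, hball⟩ := Metric.mem_nhds_iff.1 (inter_mem hO hW)
  by_contra hcon
  rw [Filter.not_eventually] at hcon
  have hnear : ∀ᶠ q in 𝓝 p, q ∈ φ.source ∧ φ q ∈ Metric.ball (φ p) (ρ / 8) :=
    (Filter.eventually_of_mem (extChartAt_source_mem_nhds p) fun q hq => hq).and
      ((continuousAt_extChartAt p) (Metric.ball_mem_nhds _ (by positivity)))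
  -- The radius `ρ / 8` ensures that a point of the complement nearest to `φ q` lies in the open
  -- ball of radius `ρ / 2`, because `φ p` itself is a competitor.
  obtain ⟨q, hq, hqs, hqb⟩ := (hcon.and_eventually hnear).exists
  simp only [Classical.not_imp, not_not] at hq
  obtain ⟨hqP, hqu⟩ := hq
  set a := φ q with ha
  have hqa : φ.symm a = q := φ.left_inv hqs
  have hcball : Metric.closedBall (φ p) (ρ / 2) ⊆ Metric.ball (φ p) ρ :=
    Metric.closedBall_subset_ball (by linarith)
  have hcontf : ContinuousOn f (Metric.closedBall (φ p) (ρ / 2)) := fun z hz =>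
    (hfsm z (hball (hcball hz)).1).continuousAt.continuousWithinAt
  have hcontφ : ContinuousOn φ.symm (Metric.closedBall (φ p) (ρ / 2)) :=
    (continuousOn_extChartAt_symm p).mono fun z hz => (hball (hcball hz)).1.1
  set C : Set (ℝ × EuclideanSpace ℝ (Fin n)) := (Metric.closedBall (φ p) (ρ / 2) ∩ f ⁻¹' {0}) ∩
    (Metric.closedBall (φ p) (ρ / 2) ∩ φ.symm ⁻¹' uᶜ) with hC
  have hCc : IsCompact C := by
    refine (isCompact_closedBall (φ p) (ρ / 2)).of_isClosed_subset ?_ fun z hz => hz.1.1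
    exact (hcontf.preimage_isClosed_of_isClosed Metric.isClosed_closedBall isClosed_singleton).inter
      (hcontφ.preimage_isClosed_of_isClosed Metric.isClosed_closedBall hu.isClosed_compl)
  have hCmem : ∀ z ∈ Metric.closedBall (φ p) (ρ / 2), φ.symm z ∈ P → φ.symm z ∉ u → z ∈ C :=
    fun z hz hzP hzu => ⟨⟨hz, (hiff _ (hball (hcball hz)).1.2).1 hzP⟩, hz, hzu⟩
  have hpC : φ p ∈ C := hCmem _ (Metric.mem_closedBall_self (by positivity))
    (by rw [hinv]; exact hp) (by rw [hinv]; exact hpu)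
  -- Distance is measured by `auxInner`, since the product norm is a maximum and not differentiable.
  have hQcont : Continuous fun z => auxInner (z - a) (z - a) := by
    simp only [auxInner_self]
    fun_prop
  obtain ⟨c, hcC, hcmin⟩ := hCc.exists_isMinOn ⟨φ p, hpC⟩ hQcont.continuousOn
  have hcU := (hball (hcball hcC.1.1)).1
  have hcP : φ.symm c ∈ P := (hiff _ hcU.2).2 hcC.1.2
  have hcu : φ.symm c ∉ u := hcC.2.2
  have hac : a ≠ c := by
    rintro h
    rw [← h, hqa] at hcu
    exact hcu hqu
  have hcin : c ∈ Metric.ball (φ p) (ρ / 2) := by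
    have h1 := norm_sq_le_auxInner (c - a)
    have h2 : auxInner (c - a) (c - a) ≤ auxInner (φ p - a) (φ p - a) := hcmin hpC
    have h3 := (le_abs_self _).trans (abs_auxInner_le (φ p - a) (φ p - a))
    rw [Metric.mem_ball, dist_eq_norm] at hqb ⊢
    rw [norm_sub_rev] at hqb
    have h4 : ‖c - a‖ < ρ / 4 := by
      refine lt_of_pow_lt_pow_left₀ 2 (by positivity) ?_
      nlinarith [norm_nonneg (φ p - a)]
    calc ‖c - φ p‖ = ‖(c - a) - (φ p - a)‖ := by congr 1; abel
      _ ≤ ‖c - a‖ + ‖φ p - a‖ := norm_sub_le _ _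
      _ < ρ / 2 := by linarith
  have haW : a ∈ Metric.ball (φ p) ρ := Metric.ball_subset_ball (by linarith) hqb
  obtain ⟨y, hy, hyne⟩ := hWy a (hball haW).2 c (hball (hcball hcC.1.1)).2
    ((hiff _ (hball haW).1.2).1 (by rw [hqa]; exact hqP)) hcC.1.2 hac
  set L : (ℝ × EuclideanSpace ℝ (Fin n)) →L[ℝ] (ℝ × EuclideanSpace ℝ (Fin n)) :=
    mfderiv (spacetimeModel n) 𝓘(ℝ, ℝ × EuclideanSpace ℝ (Fin n)) φ (φ.symm c) with hL
  have hcsrc : φ.symm c ∈ φ.source := φ.map_target hcU.1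
  have hnull : ∀ w : ℝ × EuclideanSpace ℝ (Fin n), w ≠ 0 →
      S.lorentzMetric (φ.symm c) w w = 0 →
      w ∈ tangentSet (spacetimeModel n) P (φ.symm c) → ((auxInner (c - a)).comp L) w = 0 := by
    intro w hw hw0 hwT
    obtain ⟨γ, J, hγ, h0, hγ0, hγv, hγP⟩ := hP.exists_nullGeodesic hcP hw hw0 hwT
    have hγu : ∀ s ∈ J, γ s ∉ u := fun s hs h => by
      have := hsat γ J hγ hγP s hs 0 h0 h
      rw [hγ0] at this
      exact hcu this
    have hγd := S.mdifferentiableAt_of_isGeodesicOn hγ.toIsGeodesicOn h0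
    have hder : HasDerivAt (fun r => φ (γ r)) (L w) 0 := by
      have h := hasDerivAt_extChartAt_comp (x := p) hγd (by rw [hγ0]; exact hcsrc)
      rw [hγv, hγ0] at h
      exact h
    have hφc : φ (γ 0) = c := by rw [hγ0]; exact φ.right_inv hcU.1
    -- By saturation the geodesic through `c` stays in the complement of `u`, so its nearby points
    -- compete with the minimizer `c`.
    have hmin : IsLocalMin (fun r => auxInner (φ (γ r) - a) (φ (γ r) - a)) 0 := by
      have h1 : ∀ᶠ r in 𝓝 (0 : ℝ), φ (γ r) ∈ Metric.ball (φ p) (ρ / 2) := by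
        refine hder.continuousAt (Metric.isOpen_ball.mem_nhds ?_)
        rw [hφc]
        exact hcin
      have h2 : ∀ᶠ r in 𝓝 (0 : ℝ), γ r ∈ φ.source := by
        refine hγd.continuousAt ((isOpen_extChartAt_source p).mem_nhds ?_)
        rw [hγ0]
        exact hcsrc
      filter_upwards [h1, h2, hγ.isOpen.mem_nhds h0] with r hr1 hr2 hr3
      beta_reduce
      rw [hφc]
      have h3 : φ.symm (φ (γ r)) = γ r := φ.left_inv hr2
      exact hcmin (hCmem _ (Metric.ball_subset_closedBall hr1) (by rw [h3]; exact (hγP r hr3).1)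
        (by rw [h3]; exact hγu r hr3))
    have h4 := hmin.hasDerivAt_eq_zero (hasDerivAt_auxInner_self (hder.sub_const a))
    rw [hφc] at h4
    simpa using h4
  set y' : ℝ × EuclideanSpace ℝ (Fin n) := mfderiv 𝓘(ℝ, ℝ × EuclideanSpace ℝ (Fin n))
    (spacetimeModel n) φ.symm c y with hy'
  have hy'T : y' ∈ tangentSet (spacetimeModel n) P (φ.symm c) := by
    refine ⟨F, ⟨U, hU, hcU.2, hsm, hd, hiff⟩, ?_⟩
    have h := fderiv_comp_extChartAt_symm hcU.1 (hsm.contMDiffAt (hU.mem_nhds hcU.2)) y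
    exact h.symm.trans hy
  have hLy' : L y' = y := by
    have : IsManifold (spacetimeModel n) 1 (ℝ × M) :=
      IsManifold.of_le (n := ∞) (by exact_mod_cast le_top)
    have h := mfderiv_extChartAt_comp_mfderivWithin_extChartAt_symm (I := spacetimeModel n) hcU.1
    rw [range_spacetimeModel, mfderivWithin_univ] at h
    exact congrArg (fun L => L y) h
  have := eq_zero_of_null_eq_zero hn hP hequi hnd hcP hnull hy'T
  rw [ContinuousLinearMap.comp_apply, hLy'] at this
  exact hyne this

/-- The points near which `P` avoids `u` form a second open set. Together with `u` it covers `P`,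
and the two are disjoint on `P`, so connectedness applies. -/
theorem subset_of_saturated (hn : 2 ≤ n) (hP : S.IsPhotonSurface P)
    (hequi : S.IsEquipotential P) (hnd : S.IsNondegenerate P) {u : Set (ℝ × M)} (hu : IsOpen u)
    (hne : (P ∩ u).Nonempty)
    (hsat : ∀ (γ : ℝ → ℝ × M) (J : Set ℝ),
      IsNullGeodesicOn (spacetimeModel n) S.lorentzMetric γ J →
      (∀ s ∈ J, γ s ∈ P ∧
        velocity (spacetimeModel n) γ s ∈ tangentSet (spacetimeModel n) P (γ s)) →
      ∀ s ∈ J, ∀ s' ∈ J, γ s ∈ u → γ s' ∈ u) : P ⊆ u := by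
  have hv : IsOpen {p : ℝ × M | ∀ᶠ q in 𝓝 p, q ∈ P → q ∉ u} := isOpen_setOfPred_eventually_nhds
  have h := isPreconnected_iff_subset_of_disjoint.1 hP.connected.isPreconnected u _ hu hv
    (fun p hp => by
      by_cases hpu : p ∈ u
      · exact Or.inl hpu
      · exact Or.inr (eventually_notMem_of_saturated hn hP hequi hnd hu hsat hp hpu))
    (by
      rw [Set.eq_empty_iff_forall_notMem]
      rintro p ⟨hpP, hpu, hpv⟩
      exact hpv.self_of_nhds hpP hpu)
  rcases h with h | h
  · exact h
  · obtain ⟨p, hpP, hpu⟩ := hne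
    exact absurd hpu ((h hpP).self_of_nhds hpP)

end ElectrostaticSystem

/-! ### Nonvanishing of a differential is an open condition -/

section Charts

variable {E : Type*} [NormedAddCommGroup E] [NormedSpace ℝ E]
  {H : Type*} [TopologicalSpace H] {I : ModelWithCorners ℝ E H} [I.Boundaryless]
  {X : Type*} [TopologicalSpace X] [ChartedSpace H X] [IsManifold I ∞ X]

theorem eventually_mfderiv_ne_zero {x : X} {F : X → ℝ} (hF : ContMDiff I 𝓘(ℝ, ℝ) ∞ F)
    (hx : mfderiv I 𝓘(ℝ, ℝ) F x ≠ 0) : ∀ᶠ y in 𝓝 x, mfderiv I 𝓘(ℝ, ℝ) F y ≠ 0 := by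
  have hd := hasStrictFDerivAt_comp_extChartAt_symm (hF x)
  have hcd := contDiffAt_comp_extChartAt_symm (mem_extChartAt_target (I := I) x)
    (hF ((extChartAt I x).symm (extChartAt I x x)))
  have hne : fderiv ℝ (fun y => F ((extChartAt I x).symm y)) (extChartAt I x x) ≠ 0 := by
    have key : ∀ L : E →L[ℝ] ℝ, HasStrictFDerivAt (fun y => F ((extChartAt I x).symm y)) L
        (extChartAt I x x) → L ≠ 0 →
        fderiv ℝ (fun y => F ((extChartAt I x).symm y)) (extChartAt I x x) ≠ 0 :=
      fun L h hL => h.hasFDerivAt.fderiv.trans_ne hL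
    exact key _ hd hx
  have hc : ContinuousAt (fderiv ℝ (fun y => F ((extChartAt I x).symm y))) (extChartAt I x x) :=
    (hcd.fderiv_right (m := 0) (by simp)).continuousAt
  filter_upwards [(continuousAt_extChartAt x).eventually (hc.eventually_ne hne),
    extChartAt_source_mem_nhds (I := I) x] with y hy hys h0
  refine hy (ContinuousLinearMap.ext fun v => ?_)
  rw [fderiv_comp_extChartAt_symm ((extChartAt I x).map_source hys) (hF _)]
  have hL : mfderiv I 𝓘(ℝ, ℝ) F ((extChartAt I x).symm (extChartAt I x y)) = 0 := by
    rw [(extChartAt I x).left_inv hys]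
    exact h0
  rw [hL]
  rfl

end Charts

namespace ElectrostaticSystem

variable {n : ℕ} {M : Type*} [TopologicalSpace M]
  [ChartedSpace (EuclideanSpace ℝ (Fin n)) M] [IsManifold (𝓡 n) ∞ M]
  {S : ElectrostaticSystem n M} {P : Set (ℝ × M)}

/-! ## Reflection at exceptional times -/

/-- A nonzero null vector has nonzero time component because `g` is positive definite; hence time is
a local parameter along null geodesics. -/
theorem hasStrictDerivAt_time {γ : ℝ → ℝ × M} {J : Set ℝ}
    (hγ : IsNullGeodesicOn (spacetimeModel n) S.lorentzMetric γ J) {s : ℝ} (hs : s ∈ J) :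
    ∃ τ' : ℝ, τ' ≠ 0 ∧ HasStrictDerivAt (fun r => (γ r).1) τ' s := by
  have hsm := (hγ.smooth s hs).contMDiffAt (hγ.isOpen.mem_nhds hs)
  have h1 : ContDiffAt ℝ ∞ (fun r => (γ r).1) s :=
    contMDiffAt_iff_contDiffAt.1 (contMDiffAt_fst.comp s hsm)
  have h2 := h1.hasStrictDerivAt (by simp)
  refine ⟨_, ?_, h2⟩
  have h3 := (hasMFDerivAt_fst (γ s)).comp s (hsm.mdifferentiableAt (by simp)).hasMFDerivAt
  have h4 : deriv (fun r => (γ r).1) s =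
      (velocity (spacetimeModel n) γ s : ℝ × EuclideanSpace ℝ (Fin n)).1 := by
    rw [← fderiv_apply_one_eq_deriv, ← mfderiv_eq_fderiv]
    exact congrArg (fun L => L (1 : ℝ)) h3.mfderiv
  rw [h4]
  exact fst_ne_zero_of_null (hγ.velocity_ne_zero s hs) (hγ.null s hs)

/-- If a null geodesic and its time reflection lie in `P`, then `u` is symmetric along it. -/
theorem eventually_lapseAlong_symm (hequi : S.IsEquipotential P) {a : ℝ} {γ : ℝ → ℝ × M}
    {J : Set ℝ} (hγ : IsNullGeodesicOn (spacetimeModel n) S.lorentzMetric γ J)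
    (h1 : ∀ s ∈ J, γ s ∈ P) (h2 : ∀ s ∈ J, reflect a (γ s) ∈ P) {s : ℝ} (hs : s ∈ J) :
    ∀ᶠ t in 𝓝 (γ s).1, S.lapseAlong P t = S.lapseAlong P (2 * a - t) := by
  obtain ⟨τ', hτ', hτ⟩ := hasStrictDerivAt_time hγ hs
  have hmap := hτ.map_nhds_eq hτ'
  rw [← hmap, Filter.eventually_map]
  filter_upwards [hγ.isOpen.mem_nhds hs] with r hr
  rw [lapseAlong_eq hequi (h1 r hr)]
  exact (lapseAlong_eq hequi (h2 r hr)).symm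

/-- The time reflection of a null geodesic in `P` stays in `P` if it starts tangent to `P`. -/
theorem reflect_mem_of_geodesic (hP : S.IsPhotonSurface P) (hequi : S.IsEquipotential P)
    (hnd : S.IsNondegenerate P) {a : ℝ} {γ : ℝ → ℝ × M} {J : Set ℝ}
    (hγ : IsNullGeodesicOn (spacetimeModel n) S.lorentzMetric γ J)
    (hγP : ∀ s ∈ J, γ s ∈ P ∧
      velocity (spacetimeModel n) γ s ∈ tangentSet (spacetimeModel n) P (γ s))
    {s₀ : ℝ} (hs₀ : s₀ ∈ J) (hmem : reflect a (γ s₀) ∈ P)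
    (hder : deriv (S.lapseAlong P) (2 * a - (γ s₀).1) = -deriv (S.lapseAlong P) (γ s₀).1)
    {s : ℝ} (hs : s ∈ J) : reflect a (γ s) ∈ P := by
  have hγ' := IsNullGeodesicOn.reflect_shift S hγ a s₀
  have hd := S.mdifferentiableAt_of_isGeodesicOn hγ.toIsGeodesicOn hs₀
  have h0 : (0 : ℝ) + s₀ = s₀ := zero_add s₀
  have hv := velocity_reflect_shift a s₀ (s := 0) (γ := γ) (by rwa [h0])
  have hT := (mem_tangentSet_iff hP hequi hnd (hγP s₀ hs₀).1 _).1 (hγP s₀ hs₀).2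
  -- Reflection flips the time component of the velocity and `hder` flips `u̇`, so the tangency
  -- condition `dN(v₂) = u̇ v₁` is preserved.
  have := (hP.null_totally_geodesic _ _ hγ' (by simpa using hs₀) (by simpa using hmem) (by
    refine (mem_tangentSet_iff hP hequi hnd (p := reflect a (γ (0 + s₀)))
      (by simpa using hmem) _).2 ?_
    rw [hv, h0]
    change S.lapseDeriv (γ s₀).2 (velocity (spacetimeModel n) γ s₀).2 =
      deriv (S.lapseAlong P) (2 * a - (γ s₀).1) * -(velocity (spacetimeModel n) γ s₀).1
    rw [hder, neg_mul_neg]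
    exact hT) (s - s₀) (by simpa using hs)).1
  simpa using this

/-- Near the reflected point `P` is the set `N = u(t)`, and for `q ∈ P` near `p` symmetry gives `N =
u(q.1) = u(2a - q.1)`. -/
theorem eventually_reflect_mem (hP : S.IsPhotonSurface P) (hequi : S.IsEquipotential P)
    (hnd : S.IsNondegenerate P) {a : ℝ} {p : ℝ × M} (hp : reflect a p ∈ P)
    (hu : ∀ᶠ t in 𝓝 p.1, S.lapseAlong P t = S.lapseAlong P (2 * a - t)) :
    ∀ᶠ q in 𝓝 p, q ∈ P → reflect a q ∈ P ∧
      ∀ᶠ t in 𝓝 q.1, S.lapseAlong P t = S.lapseAlong P (2 * a - t) := by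
  have h1 := (continuous_reflect a).continuousAt.eventually (eventually_mem_iff hP hequi hnd hp)
  have h2 := (continuous_fst.continuousAt (x := p)).eventually (eventually_eventually_nhds.2 hu)
  filter_upwards [h1, h2] with q hq1 hq2 hqP
  refine ⟨hq1.2 ?_, hq2⟩
  have h3 := lapseAlong_eq hequi hqP
  rw [hq2.self_of_nhds] at h3
  exact h3.symm

theorem deriv_eq_neg_of_symm {u : ℝ → ℝ} {a t : ℝ} (h : ∀ᶠ r in 𝓝 t, u r = u (2 * a - r)) :
    deriv u (2 * a - t) = -deriv u t := by
  have h1 : deriv u t = deriv (fun r => u (2 * a - r)) t := Filter.EventuallyEq.deriv_eq h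
  rw [h1, deriv_comp_const_sub, neg_neg]

/-- A photon surface is invariant under the reflection at each of its exceptional times. -/
theorem reflect_mem_of_exceptional (hn : 2 ≤ n) (hP : S.IsPhotonSurface P)
    (hequi : S.IsEquipotential P) (hnd : S.IsNondegenerate P) {a : ℝ}
    (ha : a ∈ S.exceptionalTimes P) {p : ℝ × M} (hp : p ∈ P) : reflect a p ∈ P := by
  -- Phrasing the condition on a neighbourhood, and only for points of `P`, makes this set open in
  -- the spacetime; on `P` it reduces to the pointwise condition by `eventually_reflect_mem`.
  set u : Set (ℝ × M) := {p | ∀ᶠ q in 𝓝 p, q ∈ P → reflect a q ∈ P ∧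
    ∀ᶠ t in 𝓝 q.1, S.lapseAlong P t = S.lapseAlong P (2 * a - t)} with hu
  have hopen : IsOpen u := isOpen_setOfPred_eventually_nhds
  have hiff : ∀ q ∈ P, (q ∈ u ↔ reflect a q ∈ P ∧
      ∀ᶠ t in 𝓝 q.1, S.lapseAlong P t = S.lapseAlong P (2 * a - t)) := fun q hq =>
    ⟨fun h => h.self_of_nhds hq, fun h => eventually_reflect_mem hP hequi hnd h.1 h.2⟩
  have hsub : P ⊆ u := by
    refine subset_of_saturated hn hP hequi hnd hopen ?_ ?_
    · obtain ⟨⟨x, hx⟩, hd0⟩ := ha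
      have hrx : reflect a (a, x) = (a, x) := by
        simp only [reflect]
        congr 1
        ring
      obtain ⟨w, hw, hw0, hwT⟩ := exists_null_tangent hn hP hequi hnd hx
      obtain ⟨γ, J, hγ, h0, hγ0, -, hγP⟩ := hP.exists_nullGeodesic hx hw hw0 hwT
      have hrefl : ∀ s ∈ J, reflect a (γ s) ∈ P := fun s hs =>
        reflect_mem_of_geodesic hP hequi hnd hγ hγP h0 (by rwa [hγ0, hrx])
          (by rw [hγ0]; simp only; rw [show 2 * a - a = a by ring, hd0, neg_zero]) hs
      refine ⟨(a, x), hx, (hiff _ hx).2 ⟨by rwa [hrx], ?_⟩⟩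
      have := eventually_lapseAlong_symm hequi hγ (fun s hs => (hγP s hs).1) hrefl h0
      rwa [hγ0] at this
    · intro γ J hγ hγP s hs s' hs' hsu
      obtain ⟨h1, h2⟩ := (hiff _ (hγP s hs).1).1 hsu
      have hrefl : ∀ s ∈ J, reflect a (γ s) ∈ P := fun r hr =>
        reflect_mem_of_geodesic hP hequi hnd hγ hγP hs h1 (deriv_eq_neg_of_symm h2) hr
      exact (hiff _ (hγP s' hs').1).2 ⟨hrefl s' hs', eventually_lapseAlong_symm hequi hγ
        (fun s hs => (hγP s hs).1) hrefl hs'⟩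
  exact ((hiff p hp).1 (hsub hp)).1

/-! ## Translations -/

/-- The time translations that preserve `P`. -/
def translations (P : Set (ℝ × M)) : AddSubgroup ℝ where
  carrier := {d | ∀ t x, (t, x) ∈ P ↔ (t + d, x) ∈ P}
  zero_mem' := by simp
  add_mem' := by
    intro d e hd he t x
    rw [hd, he, add_assoc]
  neg_mem' := by
    intro d hd t x
    rw [hd (t + -d)]
    simp

theorem mem_translations {d : ℝ} :
    d ∈ translations P ↔ ∀ t x, (t, x) ∈ P ↔ (t + d, x) ∈ P := Iff.rfl

/-- The translation is the reflection at `a` followed by the one at `b`; the opposite order gives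
its inverse. -/
theorem two_mul_sub_mem_translations (hn : 2 ≤ n) (hP : S.IsPhotonSurface P)
    (hequi : S.IsEquipotential P) (hnd : S.IsNondegenerate P) {a b : ℝ}
    (ha : a ∈ S.exceptionalTimes P) (hb : b ∈ S.exceptionalTimes P) :
    2 * (b - a) ∈ translations P := by
  have key : ∀ a ∈ S.exceptionalTimes P, ∀ b ∈ S.exceptionalTimes P, ∀ t x, (t, x) ∈ P →
      (t + 2 * (b - a), x) ∈ P := by
    intro a ha b hb t x h
    have h1 := reflect_mem_of_exceptional hn hP hequi hnd hb
      (reflect_mem_of_exceptional hn hP hequi hnd ha h)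
    simp only [reflect] at h1
    convert h1 using 2
    ring
  refine mem_translations.2 fun t x => ⟨key a ha b hb t x, fun h => ?_⟩
  have := key b hb a ha _ x h
  convert this using 2
  ring

/-- If exceptional times are arbitrarily close to each other, then `P` is a photon sphere. -/
theorem isPhotonSphere_of_close (hn : 2 ≤ n) (hP : S.IsPhotonSurface P)
    (hequi : S.IsEquipotential P) (hnd : S.IsNondegenerate P)
    (hclose : ∀ ε > 0, ∃ t ∈ S.exceptionalTimes P, ∃ t' ∈ S.exceptionalTimes P,
      t ≠ t' ∧ |t - t'| ≤ ε) : S.IsPhotonSphere P := by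
  have hdense : Dense (translations P : Set ℝ) := by
    refine AddSubgroup.dense_of_not_isolated_zero _ fun ε hε => ?_
    -- The factor `1 / 3` leaves room for the doubling: the resulting translation `2 * |t - t'|` is
    -- strictly below `ε`.
    obtain ⟨t, ht, t', ht', hne, hle⟩ := hclose (ε / 3) (by positivity)
    have hpos : 0 < |t - t'| := abs_pos.2 (sub_ne_zero.2 hne)
    refine ⟨2 * |t - t'|, ?_, by linarith, by linarith⟩
    rcases abs_choice (t - t') with h | h <;> rw [h]
    · exact two_mul_sub_mem_translations hn hP hequi hnd ht' ht
    · rw [neg_sub]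
      exact two_mul_sub_mem_translations hn hP hequi hnd ht ht'
  have hopen : IsOpen (times P) :=
    isOpen_iff_mem_nhds.2 fun t ht => (differentiableAt_lapseAlong hP hequi ht).2
  obtain ⟨p₀, hp₀⟩ := hP.connected.nonempty
  have hshift : ∀ d ∈ translations P, ∀ t ∈ times P, t + d ∈ times P ∧
      S.lapseAlong P (t + d) = S.lapseAlong P t := by
    rintro d hd t ⟨x, hx⟩
    have hx' := (hd t x).1 hx
    exact ⟨⟨x, hx'⟩, (lapseAlong_eq hequi hx').trans (lapseAlong_eq hequi hx).symm⟩
  have hmove : ∀ O : Set ℝ, IsOpen O → O.Nonempty → ∀ s : ℝ, ∃ d ∈ translations P, s + d ∈ O := by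
    intro O hO hne s
    obtain ⟨d, hd, hdO⟩ := hdense.inter_open_nonempty ((fun d => s + d) ⁻¹' O)
      (hO.preimage (by fun_prop)) (by
        obtain ⟨r, hr⟩ := hne
        exact ⟨r - s, by simpa using hr⟩)
    exact ⟨d, hdO, hd⟩
  have htimes : ∀ s, s ∈ times P := fun s => by
    obtain ⟨d, hd, hds⟩ := hmove (times P) hopen ⟨_, mem_times hp₀⟩ s
    have := (hshift (-d) (neg_mem hd) _ hds).1
    simpa using this
  have hcont : Continuous (S.lapseAlong P) := continuous_iff_continuousAt.2 fun t =>
    (differentiableAt_lapseAlong hP hequi (htimes t)).1.continuousAt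
  have hconst : ∀ s, S.lapseAlong P s = S.lapseAlong P 0 := by
    have h : (fun s => S.lapseAlong P s) = fun _ => S.lapseAlong P 0 :=
      Continuous.ext_on hdense hcont continuous_const fun d hd => by
        simpa using (hshift d hd 0 (htimes 0)).2
    exact fun s => congrFun h s
  -- As `u` is constant, `P` contains `(r, x)` for all `r` near `t`. A translation from the dense
  -- group carries `s` to such an `r`, and its inverse brings `(r, x)` back to `(s, x)`.
  have hprod : ∀ t s x, (t, x) ∈ P → (s, x) ∈ P := by
    intro t s x hx
    have h1 : ∀ᶠ r in 𝓝 t, (r, x) ∈ P := by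
      have hc : ContinuousAt (fun r : ℝ => (r, x)) t := by fun_prop
      filter_upwards [hc.eventually (eventually_mem_iff hP hequi hnd hx)] with r hr
      rw [hr, hconst, ← hconst t]
      exact (lapseAlong_eq hequi hx).symm
    obtain ⟨O, hOs, hO, htO⟩ := eventually_nhds_iff.1 h1
    obtain ⟨d, hd, hds⟩ := hmove O hO ⟨t, htO⟩ s
    exact (hd s x).2 (hOs _ hds)
  refine ⟨hP, ⟨{x | ((0 : ℝ), x) ∈ P}, ?_, ?_⟩, ?_⟩
  · intro x hx
    refine ⟨fun y => S.lapse y - S.lapseAlong P 0, ?_⟩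
    have hc : ContinuousAt (fun y : M => ((0 : ℝ), y)) x := by fun_prop
    have h1 := hc.eventually (eventually_mem_iff hP hequi hnd hx)
    have h2 := eventually_mfderiv_ne_zero S.lapse_smooth (hnd _ hx)
    obtain ⟨O, hOs, hO, hxO⟩ := eventually_nhds_iff.1 (h1.and h2)
    refine ⟨O, hO, hxO, (S.lapse_smooth.sub contMDiff_const).contMDiffOn, fun y hy => ?_,
      fun y hy => ?_⟩
    · have h3 := (S.lapse_smooth.mdifferentiable (by simp) y).hasMFDerivAt.sub
        (hasMFDerivAt_const (I := 𝓡 n) (I' := 𝓘(ℝ, ℝ)) (S.lapseAlong P 0) y)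
      have h4 : mfderiv (𝓡 n) 𝓘(ℝ, ℝ) (fun y => S.lapse y - S.lapseAlong P 0) y =
        mfderiv (𝓡 n) 𝓘(ℝ, ℝ) S.lapse y :=
        h3.mfderiv.trans (ContinuousLinearMap.ext fun v => sub_zero _)
      rw [h4]
      exact (hOs y hy).2
    · rw [sub_eq_zero]
      exact (hOs y hy).1
  · ext ⟨t, x⟩
    exact ⟨fun h => ⟨mem_univ _, hprod t 0 x h⟩, fun h => hprod 0 t x h.2⟩
  · rintro ⟨t, x⟩ hp ⟨s, y⟩ hq
    exact hequi s x y (hprod t s x hp) hq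

end ElectrostaticSystem

end PhotonSurface

/-! ### The proposition -/

theorem mainTheorem11 (n : ℕ) (hn : 2 ≤ n) (M : Type*) [TopologicalSpace M] [T2Space M]
    [SecondCountableTopology M] [ConnectedSpace M]
    [ChartedSpace (EuclideanSpace ℝ (Fin n)) M] [IsManifold (𝓡 n) ∞ M]
    (S : PhotonSurface.ElectrostaticSystem n M) (P : Set (ℝ × M))
    (hP : S.IsPhotonSurface P) (hequi : S.IsEquipotential P) (hnd : S.IsNondegenerate P) :
    (¬ S.IsPhotonSphere P →
      (S.exceptionalTimes P).Countable ∧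
      (∃ ε : ℝ, 0 < ε ∧ ∀ t ∈ S.exceptionalTimes P, ∀ t' ∈ S.exceptionalTimes P,
        t ≠ t' → ε < |t - t'|)) ∧
    (∀ t₀ ∈ PhotonSurface.ElectrostaticSystem.times P,
      AccPt t₀ (𝓟 (S.exceptionalTimes P)) → S.IsPhotonSphere P) := by
  constructor
  · intro hns
    obtain ⟨ε, hε, h⟩ : ∃ ε : ℝ, 0 < ε ∧ ∀ t ∈ S.exceptionalTimes P,
        ∀ t' ∈ S.exceptionalTimes P, t ≠ t' → ε < |t - t'| := by
      by_contra hcon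
      push Not at hcon
      exact hns (PhotonSurface.ElectrostaticSystem.isPhotonSphere_of_close hn hP hequi hnd hcon)
    refine ⟨?_, ε, hε, h⟩
    -- Two times in the same interval `[kε, (k + 1)ε)` are less than `ε` apart, so each interval
    -- contains at most one exceptional time.
    have hinj : Set.InjOn (fun t : ℝ => ⌊t / ε⌋) (S.exceptionalTimes P) := by
      intro t ht t' ht' heq
      by_contra hne
      have h1 := Int.abs_sub_lt_one_of_floor_eq_floor heq
      rw [← sub_div, abs_div, abs_of_pos hε, div_lt_one hε] at h1
      exact absurd h1 (h t ht t' ht' hne).not_gt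
    exact Set.countable_of_injective_of_countable_image hinj (Set.to_countable _)
  · intro t₀ _ hacc
    refine PhotonSurface.ElectrostaticSystem.isPhotonSphere_of_close hn hP hequi hnd fun ε hε => ?_
    rw [accPt_iff_nhds] at hacc
    obtain ⟨t, ⟨htb, ht⟩, htne⟩ := hacc _ (Metric.ball_mem_nhds t₀ (half_pos hε))
    have hpos : 0 < dist t t₀ := dist_pos.2 htne
    -- Taking `t'` strictly closer to `t₀` than `t` makes the two times distinct.
    obtain ⟨t', ⟨htb', ht'⟩, htne'⟩ := hacc _ (Metric.ball_mem_nhds t₀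
      (lt_min (half_pos hε) hpos))
    rw [Metric.mem_ball] at htb htb'
    refine ⟨t, ht, t', ht', ?_, ?_⟩
    · rintro rfl
      exact absurd (htb'.trans_le (min_le_right _ _)) (lt_irrefl _)
    · rw [← Real.dist_eq]
      have := dist_triangle_right t t' t₀
      have h1 := htb'.trans_le (min_le_left _ _)
      linarith
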